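/- Fix $0<q<1$, let $\mathbb A=\{z\in\mathbb C: q<|z|<1\}$, $B_q=\{|z|=q\}$, $B_1=\{|z|=1\}$, $B=B_q\cup B_1$, and let $\mu=\mu_1+\mu_q$, where $\mu_j$ is the multiple of arclength measure on $B_j$ with $\mu_j(B_j)=2\pi$. For $\alpha\in[0,1)$ let $H^2_\alpha$ be the space of analytic functions $F$ on the universal cover $\{(r,t): q<r<1,\ t\in\mathbb R\}$ of $\mathbb A$ (with covering map $(r,t)\mapsto re^{it}$) that satisfy $F(r,t+2\pi)=e^{2\pi i\alpha}F(r,t)$ and have boundary values in $L^2(\mu)$, attained in the sense that $F(r,\cdot)$ converges in $L^2(0,2\pi)$ as $r\to1^-$ and as $r\to q^+$. Through these boundary values (taken on the branch $0<t\le2\pi$) $H^2_\alpha$ is a closed subspace of $L^2(\mu)$; let $P_\alpha$ be the orthogonal projection of $L^2(\mu)$ onto it. For a real-valued $\varphi\in L^\infty(\mu)$ the Toeplitz operator $T^\alpha_\varphi:H^2_\alpha\to H^2_\alpha$ is $T^\alpha_\varphi f=P_\alpha(\varphi f)$. Let $\varphi\in L^\infty(\mu)$ be real-valued and suppose that \[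 \operatorname{ess\,sup}_{B_q}\varphi=m<0<M=\operatorname{ess\,inf}_{B_1}\varphi \quad\text{or}\quad \operatorname{ess\,sup}_{B_1}\varphi=m<0<M=\operatorname{ess\,inf}_{B_q}\varphi . \] If \[ \int_B\log|\varphi-M|\,d\mu=-\infty\quad\text{or}\quad\int_B\log|\varphi-m|\,d\mu=-\infty \] (with $\log 0=-\infty$), then for every $\alpha\in[0,1)$ the operator $T^\alpha_\varphi$ has infinitely many eigenvalues in the interval $(m,M)$. -/

import Mathlib

open Set Filter Topology MeasureTheory
open scoped ENNReal

noncomputable section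

namespace AnnulusToeplitz

/-- Lebesgue measure `dt` on one period `(0, 2π]` of the angle. -/
abbrev angleMeasure : Measure ℝ := volume.restrict (Ioc 0 (2 * Real.pi))

/-- Arclength on the circle `|z| = r`, weighted so that its total mass is `2π`
(the image of `dt` under `t ↦ r * exp (i t)`). -/
def circleMeasure (r : ℝ) : Measure ℂ :=
  Measure.map (circleMap 0 r) angleMeasure

/-- The measure `μ = μ_1 + μ_q` carried by the boundary `B = B_1 ∪ B_q` of the annulus
`q < |z| < 1`; thus `L²(B)` is `Lp ℂ 2 (boundaryMeasure q)`. -/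
def boundaryMeasure (q : ℝ) : Measure ℂ := circleMeasure 1 + circleMeasure q

/-- `F (r, t)` is an analytic, modulus automorphic function of index `α` on the universal cover
`{(r, t) | q < r < 1}` of the annulus, whose covering map is `(r, t) ↦ r * exp (i t)`. Analyticity
is expressed in the global holomorphic coordinate `w = log r + i t` of the cover. The function
`0` is regarded as having every index. -/
structure IsAutomorphic (q α : ℝ) (F : ℝ × ℝ → ℂ) : Prop where
  analytic : DifferentiableOn ℂ (fun w : ℂ => F (Real.exp w.re, w.im))
    {w : ℂ | q < Real.exp w.re ∧ Real.exp w.re < 1}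
  index : ∀ r t : ℝ, q < r → r < 1 →
    F (r, t + 2 * Real.pi) = Complex.exp (2 * Real.pi * Complex.I * α) * F (r, t)

/-- `u` is the boundary value on the circle `|z| = s` of the (multivalued) function `F`, on the
branch `0 < t ≤ 2π`: `F (r, t) → u (s * exp (i t))` in `L²(dt)` as `r` tends to `s` along `l`. -/
def HasBoundaryValue (F : ℝ × ℝ → ℂ) (s : ℝ) (l : Filter ℝ) (u : ℂ → ℂ) : Prop :=
  Tendsto (fun r : ℝ => eLpNorm (fun t : ℝ => F (r, t) - u (circleMap 0 s t)) 2 angleMeasure) l (𝓝 0)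

/-- The function `exp (-i α t) f(t)`. -/
def twist (α : ℝ) (f : ℝ → ℂ) (t : ℝ) : ℂ := Complex.exp (-(α * t * Complex.I)) * f t

/-- The coefficient of `exp (i (n + α) t)` in `f`. -/
def coef (α : ℝ) (f : ℝ → ℂ) (n : ℤ) : ℂ := fourierCoeffOn Real.two_pi_pos (twist α f) n

lemma coef_eq (α : ℝ) (f : ℝ → ℂ) (n : ℤ) :
    coef α f n = (1 / (2 * Real.pi) : ℝ) • ∫ t, Complex.exp (-((n + α) * t * Complex.I)) * f t ∂angleMeasure := by
  rw [coef, fourierCoeffOn_eq_integral, sub_zero, intervalIntegral.integral_of_le Real.two_pi_pos.le]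
  congr 2
  ext t
  rw [fourier_coe_apply, twist, smul_eq_mul, ← mul_assoc, ← Complex.exp_add]
  congr 2
  have : (Real.pi : ℂ) ≠ 0 := by exact_mod_cast Real.pi_ne_zero
  push_cast
  field_simp
  ring

lemma memLp_exp_mul (β : ℝ) {f : ℝ → ℂ} {p : ℝ≥0∞} (hf : MemLp f p angleMeasure) :
    MemLp (fun t => Complex.exp (-((β : ℂ) * (t : ℝ) * Complex.I)) * f t) p angleMeasure := by
  refine hf.of_le ?_ (Eventually.of_forall fun t => ?_)
  · exact (by fun_prop : Continuous fun t : ℝ => Complex.exp (-(β * t * Complex.I))).aestronglyMeasurable.mul hf.1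
  · rw [norm_mul, show -((β:ℂ) * t * Complex.I) = ((-(β * t) : ℝ) : ℂ) * Complex.I by push_cast; ring,
      Complex.norm_exp_ofReal_mul_I, one_mul]

lemma norm_twist (α : ℝ) (f : ℝ → ℂ) (t : ℝ) : ‖twist α f t‖ = ‖f t‖ := by
  rw [twist, norm_mul, show -((α:ℂ) * t * Complex.I) = ((-(α * t) : ℝ) : ℂ) * Complex.I by push_cast; ring,
      Complex.norm_exp_ofReal_mul_I, one_mul]

lemma coef_tendsto {ι : Type*} {l : Filter ι} (α : ℝ) {f : ι → ℝ → ℂ} {g : ℝ → ℂ}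
    (hf : ∀ᶠ i in l, MemLp (f i) 2 angleMeasure) (hg : MemLp g 2 angleMeasure)
    (h : Tendsto (fun i => eLpNorm (fun t => f i t - g t) 2 angleMeasure) l (𝓝 0)) (n : ℤ) :
    Tendsto (fun i => coef α (f i) n) l (𝓝 (coef α g n)) := by
  simp only [coef_eq]
  refine Tendsto.const_smul ?_ _
  have e : ((n:ℂ) + α) = ((n + α : ℝ) : ℂ) := by push_cast; ring
  simp only [e]
  have one_two : (1 : ℝ≥0∞) ≤ 2 := by norm_num
  refine tendsto_integral_of_L1' _ (memLp_exp_mul _ hg).1 ?_ ?_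
  · filter_upwards [hf] with i hi
    exact (memLp_exp_mul _ hi).integrable one_two
  · have h2 : Tendsto (fun i => eLpNorm (fun t => f i t - g t) 2 angleMeasure *
        angleMeasure univ ^ (1 / (1 : ℝ≥0∞).toReal - 1 / (2 : ℝ≥0∞).toReal)) l (𝓝 0) := by
      have := ENNReal.Tendsto.mul_const (b := angleMeasure univ ^ (1 / (1 : ℝ≥0∞).toReal - 1 / (2 : ℝ≥0∞).toReal)) h
        (Or.inr (ENNReal.rpow_ne_top_of_nonneg (by norm_num) (by simp [angleMeasure, ENNReal.mul_eq_top])))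
      simpa using this
    refine tendsto_of_tendsto_of_tendsto_of_le_of_le' tendsto_const_nhds h2
      (Eventually.of_forall fun _ => zero_le) ?_
    filter_upwards [hf] with i hi
    refine le_trans (le_of_eq ?_) (eLpNorm_le_eLpNorm_mul_rpow_measure_univ one_two (hi.sub hg).1)
    refine eLpNorm_congr_norm_ae (Eventually.of_forall fun t => ?_)
    have := norm_twist (n + α) (fun t => f i t - g t) t
    rw [← this, twist, Pi.sub_apply, ← mul_sub]

lemma continuous_slice {q α : ℝ} {F : ℝ × ℝ → ℂ} (hF : IsAutomorphic q α F) (hq : 0 < q) {r : ℝ}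
    (h1 : q < r) (h2 : r < 1) : Continuous fun t => F (r, t) := by
  have h0 : 0 < r := hq.trans h1
  have := hF.analytic.continuousOn.comp_continuous
    (f := fun t : ℝ => (Real.log r : ℂ) + t * Complex.I) (by fun_prop)
    (fun t => by simp [Real.exp_log h0, h1, Real.log_neg h0 h2])
  refine this.congr fun t => ?_
  simp [Real.exp_log h0]

lemma memLp_slice {q α : ℝ} {F : ℝ × ℝ → ℂ} (hF : IsAutomorphic q α F) (hq : 0 < q) {r : ℝ}
    (h1 : q < r) (h2 : r < 1) : MemLp (fun t => F (r, t)) 2 angleMeasure := by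
  have hc := continuous_slice hF hq h1 h2
  obtain ⟨C, hC⟩ := isCompact_Icc.exists_bound_of_continuousOn (s := Icc 0 (2 * Real.pi)) hc.continuousOn
  refine MemLp.of_bound hc.aestronglyMeasurable C ?_
  filter_upwards [ae_restrict_mem measurableSet_Ioc] with t ht using hC t (Ioc_subset_Icc_self ht)

lemma coef_slice {q α : ℝ} {F : ℝ × ℝ → ℂ} (hF : IsAutomorphic q α F) (hq : 0 < q) (n : ℤ) {r s : ℝ}
    (hr : r ∈ Ioo q 1) (hs : s ∈ Ioo q 1) :
    ((s ^ (n + α : ℝ) : ℝ) : ℂ) * coef α (fun t => F (r, t)) n =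
      ((r ^ (n + α : ℝ) : ℝ) : ℂ) * coef α (fun t => F (s, t)) n := by
  set S := {w : ℂ | q < Real.exp w.re ∧ Real.exp w.re < 1} with hS
  set G : ℂ → ℂ := fun w => Complex.exp (-((n + α) * w)) * F (Real.exp w.re, w.im) with hG
  have hGd : DifferentiableOn ℂ G S := by
    refine DifferentiableOn.mul ?_ hF.analytic
    exact (by fun_prop : Differentiable ℂ fun w : ℂ => Complex.exp (-((n + α) * w))).differentiableOn
  have hr0 := hq.trans hr.1
  have hs0 := hq.trans hs.1
  have key : ∀ x ∈ Ioo q 1, coef α (fun t => F (x, t)) n =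
      ((x ^ (n + α : ℝ) : ℝ) : ℂ) *
        ((1 / (2 * Real.pi) : ℝ) • ∫ t in (0:ℝ)..2 * Real.pi, G (Real.log x + t * Complex.I)) := by
    intro x hx
    have hx0 := hq.trans hx.1
    rw [coef_eq, intervalIntegral.integral_of_le Real.two_pi_pos.le, mul_smul_comm,
      ← integral_const_mul]
    congr 2
    ext t
    simp only [hG]
    rw [← mul_assoc, Real.rpow_def_of_pos hx0, Complex.ofReal_exp, ← Complex.exp_add]
    simp [Real.exp_log hx0]
    left
    congr 1
    ring
  have rect := Complex.integral_boundary_rect_eq_zero_of_differentiableOn G (Real.log r)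
    (Real.log s + (2 * Real.pi : ℝ) * Complex.I) (hGd.mono ?_)
  · have per : ∀ x : ℝ, G (x + (2 * Real.pi : ℝ) * Complex.I) = G (x + (0:ℝ) * Complex.I) ∨ ¬ (q < Real.exp x ∧ Real.exp x < 1) := by
      intro x
      by_cases hx : q < Real.exp x ∧ Real.exp x < 1
      · left
        have := hF.index (Real.exp x) 0 hx.1 hx.2
        simp only [hG]
        simp at this ⊢
        rw [this, ← mul_assoc, ← Complex.exp_add]
        congr 1
        rw [Complex.exp_eq_exp_iff_exists_int]
        exact ⟨-n, by push_cast; ring⟩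
      · exact Or.inr hx
    have hh : (∫ x : ℝ in Real.log r..Real.log s, G (x + (2 * Real.pi : ℝ) * Complex.I)) =
        ∫ x : ℝ in Real.log r..Real.log s, G (x + (0:ℝ) * Complex.I) := by
      refine intervalIntegral.integral_congr fun x hx => (per x).resolve_right ?_
      push Not
      rw [mem_uIcc] at hx
      constructor
      · rw [← Real.log_lt_iff_lt_exp hq]
        have := Real.log_lt_log hq hr.1
        have := Real.log_lt_log hq hs.1
        rcases hx with hx | hx <;> linarith
      · rw [Real.exp_lt_one_iff]
        have := Real.log_neg hr0 hr.2
        have := Real.log_neg hs0 hs.2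
        rcases hx with hx | hx <;> linarith
    have e2 : ∫ t in (0:ℝ)..2 * Real.pi, G (Real.log s + t * Complex.I) =
        ∫ t in (0:ℝ)..2 * Real.pi, G (Real.log r + t * Complex.I) := by
      simp at rect hh
      rw [hh, sub_self, zero_add, ← mul_sub] at rect
      have := (mul_eq_zero.mp rect).resolve_left Complex.I_ne_zero
      simpa using sub_eq_zero.mp this
    rw [key r hr, key s hs, e2]
    ring
  · intro w hw
    rw [Complex.mem_reProdIm] at hw
    have hx := hw.1
    simp at hx
    rw [mem_uIcc] at hx
    constructor
    · rw [← Real.log_lt_iff_lt_exp hq]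
      have := Real.log_lt_log hq hr.1
      have := Real.log_lt_log hq hs.1
      rcases hx with hx | hx <;> linarith
    · rw [Real.exp_lt_one_iff]
      have := Real.log_neg hr0 hr.2
      have := Real.log_neg hs0 hs.2
      rcases hx with hx | hx <;> linarith

lemma summable_exp_abs (α δ : ℝ) (hδ : 0 < δ) :
    Summable fun n : ℤ => Real.exp (-(δ * |(n : ℝ) + α|)) := by
  have h1 : Summable fun n : ℕ => Real.exp (-(δ * |((n : ℤ) : ℝ)|)) := by
    have := Real.summable_exp_nat_mul_iff.mpr (show -δ < 0 by linarith)
    refine this.congr fun n => ?_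
    simp
    ring
  have h2 : Summable fun n : ℤ => Real.exp (-(δ * |(n : ℝ)|)) := by
    refine Summable.of_nat_of_neg h1 ?_
    simpa using h1
  refine Summable.of_nonneg_of_le (fun _ => (Real.exp_pos _).le) (fun n => ?_)
    (h2.mul_left (Real.exp (δ * |α|)))
  rw [← Real.exp_add, Real.exp_le_exp]
  have := abs_sub ((n : ℝ) + α) α
  rw [add_sub_cancel_right] at this
  nlinarith

/-- The series `∑ b_n z ^ (n + α)` on the universal cover. -/
def laurent (α : ℝ) (b : ℤ → ℂ) (p : ℝ × ℝ) : ℂ :=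
  ∑' n : ℤ, b n * Complex.exp ((n + α) * (Real.log p.1 + p.2 * Complex.I))

lemma term_bound {q α : ℝ} {b : ℤ → ℂ} (hq : 0 < q) (h1 : Summable fun n => ‖b n‖ ^ 2)
    (h2 : Summable fun n : ℤ => (‖b n‖ * q ^ (n + α : ℝ)) ^ 2) {x y : ℝ} (hx : Real.log q < x)
    (hy : y < 0) :
    ∃ u : ℤ → ℝ, Summable u ∧ ∀ n (w : ℂ), x ≤ w.re → w.re ≤ y →
      ‖b n * Complex.exp ((n + α) * w)‖ ≤ u n := by
  set δ := min (-y) (x - Real.log q)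
  have hδ : 0 < δ := lt_min (by linarith) (by linarith)
  obtain ⟨A, hA0, hA⟩ : ∃ A : ℝ, 0 ≤ A ∧ ∀ n, ‖b n‖ ≤ A ∧ ‖b n‖ * q ^ (n + α : ℝ) ≤ A := by
    refine ⟨Real.sqrt (∑' n, ‖b n‖ ^ 2) + Real.sqrt (∑' n : ℤ, (‖b n‖ * q ^ (n + α : ℝ)) ^ 2),
      by positivity, fun n => ⟨?_, ?_⟩⟩
    · have := Real.le_sqrt_of_sq_le (h1.le_tsum n (fun _ _ => by positivity))
      linarith [Real.sqrt_nonneg (∑' n : ℤ, (‖b n‖ * q ^ (n + α : ℝ)) ^ 2)]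
    · have := Real.le_sqrt_of_sq_le (h2.le_tsum n (fun _ _ => by positivity))
      linarith [Real.sqrt_nonneg (∑' n : ℤ, ‖b n‖ ^ 2)]
  refine ⟨_, (summable_exp_abs α δ hδ).mul_left A, fun n w hw1 hw2 => ?_⟩
  have e : ((n : ℂ) + α) * w = (((n : ℝ) + α : ℝ) : ℂ) * w := by push_cast; ring
  rw [norm_mul, Complex.norm_exp, e, Complex.re_ofReal_mul]
  rcases le_or_gt 0 ((n : ℝ) + α) with hn | hn
  · rw [abs_of_nonneg hn]
    refine mul_le_mul (hA n).1 ?_ (Real.exp_pos _).le hA0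
    rw [Real.exp_le_exp]
    have : δ ≤ -y := min_le_left _ _
    nlinarith
  · rw [abs_of_neg hn]
    have : Real.exp (((n : ℝ) + α) * w.re) =
        q ^ (n + α : ℝ) * Real.exp (((n : ℝ) + α) * (w.re - Real.log q)) := by
      rw [Real.rpow_def_of_pos hq, ← Real.exp_add]
      congr 1; ring
    rw [this, ← mul_assoc]
    refine mul_le_mul (hA n).2 ?_ (Real.exp_pos _).le hA0
    rw [Real.exp_le_exp]
    have : δ ≤ x - Real.log q := min_le_right _ _
    nlinarith

lemma laurent_automorphic {q α : ℝ} {b : ℤ → ℂ} (hq : 0 < q) (h1 : Summable fun n => ‖b n‖ ^ 2)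
    (h2 : Summable fun n : ℤ => (‖b n‖ * q ^ (n + α : ℝ)) ^ 2) :
    IsAutomorphic q α (laurent α b) where
  analytic := by
    intro w0 hw0
    have hl : Real.log q < w0.re := (Real.log_lt_iff_lt_exp hq).mpr hw0.1
    have hr : w0.re < 0 := Real.exp_lt_one_iff.mp hw0.2
    obtain ⟨x, hx1, hx2⟩ := exists_between hl
    obtain ⟨y, hy1, hy2⟩ := exists_between hr
    obtain ⟨u, hu, hb⟩ := term_bound hq h1 h2 hx1 hy2
    have hU : IsOpen {w : ℂ | x < w.re ∧ w.re < y} :=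
      (isOpen_lt continuous_const Complex.continuous_re).inter
        (isOpen_lt Complex.continuous_re continuous_const)
    have hd := Complex.differentiableOn_tsum_of_summable_norm
      (F := fun (n : ℤ) (w : ℂ) => b n * Complex.exp ((n + α) * w)) hu (U := {w : ℂ | x < w.re ∧ w.re < y})
      (fun n => (by fun_prop : Differentiable ℂ fun w : ℂ =>
        b n * Complex.exp ((n + α) * w)).differentiableOn) hU
      (fun n w hw => hb n w hw.1.le hw.2.le)
    have := (hd.differentiableAt (hU.mem_nhds ⟨hx2, hy1⟩)).differentiableWithinAt
      (s := {w : ℂ | q < Real.exp w.re ∧ Real.exp w.re < 1})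
    refine this.congr (fun w _ => ?_) ?_ <;> simp [laurent, Complex.re_add_im]
  index := by
    intro r t _ _
    rw [laurent, laurent, ← tsum_mul_left]
    congr 1
    ext n
    rw [mul_left_comm, ← Complex.exp_add]
    congr 1
    rw [Complex.exp_eq_exp_iff_exists_int]
    exact ⟨n, by push_cast; ring⟩

lemma integral_exp_int (k : ℤ) :
    ∫ t : ℝ, Complex.exp (k * t * Complex.I) ∂angleMeasure = if k = 0 then (2 * Real.pi : ℂ) else 0 := by
  rw [← intervalIntegral.integral_of_le Real.two_pi_pos.le]
  split_ifs with h
  · simp [h]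
  · have hk : (k : ℂ) * Complex.I ≠ 0 := by
      simp [h, Complex.I_ne_zero]
    have := integral_exp_mul_complex (a := 0) (b := 2 * Real.pi) hk
    rw [show (fun t : ℝ => Complex.exp (k * t * Complex.I)) =
      fun t : ℝ => Complex.exp (k * Complex.I * t) by ext t; congr 1; ring, this]
    have e : (k : ℂ) * Complex.I * ((2 * Real.pi : ℝ) : ℂ) = k * (2 * Real.pi * Complex.I) := by
      push_cast; ring
    rw [e, Complex.exp_int_mul_two_pi_mul_I]
    simp

lemma coef_laurent {q α : ℝ} {b : ℤ → ℂ} (hq : 0 < q) (h1 : Summable fun n => ‖b n‖ ^ 2)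
    (h2 : Summable fun n : ℤ => (‖b n‖ * q ^ (n + α : ℝ)) ^ 2) {r : ℝ} (hr : r ∈ Ioo q 1) (n : ℤ) :
    coef α (fun t => laurent α b (r, t)) n = ((r ^ (n + α : ℝ) : ℝ) : ℂ) * b n := by
  have hr0 := hq.trans hr.1
  obtain ⟨u, hu, hb⟩ := term_bound hq h1 h2 (x := Real.log r) (y := Real.log r)
    (Real.log_lt_log hq hr.1) (Real.log_neg hr0 hr.2)
  set c : ℤ → ℂ := fun k => b k * ((r ^ (k + α : ℝ) : ℝ) : ℂ) with hc
  have hcu : ∀ k, ‖c k‖ ≤ u k := by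
    intro k
    have := hb k (Real.log r) (by simp) (by simp)
    refine le_trans (le_of_eq ?_) this
    rw [hc, norm_mul, norm_mul]
    congr 2
    rw [Real.rpow_def_of_pos hr0]
    push_cast
    congr 1
    ring
  have hterm : ∀ k : ℤ, ∀ t : ℝ, Complex.exp (-((n + α) * t * Complex.I)) *
      (b k * Complex.exp ((k + α) * (Real.log r + t * Complex.I))) =
      c k * Complex.exp (((k - n : ℤ) : ℂ) * t * Complex.I) := by
    intro k t
    simp only [hc]
    rw [Real.rpow_def_of_pos hr0, mul_left_comm, ← Complex.exp_add, mul_assoc (b k), Complex.ofReal_exp,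
      ← Complex.exp_add]
    congr 2
    push_cast
    ring
  have hnorm : ∀ k : ℤ, ∀ t : ℝ, ‖c k * Complex.exp (((k - n : ℤ) : ℂ) * t * Complex.I)‖ = ‖c k‖ := by
    intro k t
    rw [norm_mul, show ((k - n : ℤ) : ℂ) * t * Complex.I = (((k - n : ℤ) * t : ℝ) : ℂ) * Complex.I by
      push_cast; ring, Complex.norm_exp_ofReal_mul_I, mul_one]
  rw [coef_eq]
  have hint : ∀ k : ℤ, Integrable
      (fun t : ℝ => c k * Complex.exp (((k - n : ℤ) : ℂ) * t * Complex.I)) angleMeasure := by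
    intro k
    refine Integrable.of_bound (Continuous.aestronglyMeasurable (by fun_prop)) ‖c k‖ ?_
    exact Eventually.of_forall fun t => (hnorm k t).le
  have hs := hasSum_integral_of_summable_integral_norm hint (by
    simp only [hnorm, integral_const, smul_eq_mul]
    exact (Summable.of_nonneg_of_le (fun _ => norm_nonneg _) hcu hu).mul_left _)
  have e : ∫ t, Complex.exp (-((n + α) * t * Complex.I)) * laurent α b (r, t) ∂angleMeasure =
      ∫ t, ∑' k : ℤ, c k * Complex.exp (((k - n : ℤ) : ℂ) * t * Complex.I) ∂angleMeasure := by
    refine integral_congr_ae (Eventually.of_forall fun t => ?_)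
    simp only [laurent, ← tsum_mul_left, hterm]
  rw [e, ← hs.tsum_eq]
  simp only [integral_const_mul, integral_exp_int, sub_eq_zero]
  rw [tsum_eq_single n (fun k hk => by simp [hk])]
  have : (Real.pi : ℂ) ≠ 0 := by exact_mod_cast Real.pi_ne_zero
  simp [hc]
  field_simp

lemma memLp_twist (α : ℝ) {f : ℝ → ℂ} (hf : MemLp f 2 angleMeasure) : MemLp (twist α f) 2 angleMeasure :=
  memLp_exp_mul α hf

lemma hasSum_coef (α : ℝ) {f : ℝ → ℂ} (hf : MemLp f 2 angleMeasure) :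
    HasSum (fun n => ‖coef α f n‖ ^ 2) ((2 * Real.pi)⁻¹ * ∫ t, ‖f t‖ ^ 2 ∂angleMeasure) := by
  have := hasSum_sq_fourierCoeffOn (a := 0) (b := 2 * Real.pi) Real.two_pi_pos (memLp_twist α hf)
  simp only [norm_twist] at this
  rwa [sub_zero, intervalIntegral.integral_of_le Real.two_pi_pos.le] at this

lemma coef_sub (α : ℝ) {f g : ℝ → ℂ} (hf : MemLp f 2 angleMeasure) (hg : MemLp g 2 angleMeasure) (n : ℤ) :
    coef α (fun t => f t - g t) n = coef α f n - coef α g n := by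
  have e : ((n:ℂ) + α) = ((n + α : ℝ) : ℂ) := by push_cast; ring
  rw [coef_eq, coef_eq, coef_eq, ← smul_sub]
  simp only [e]
  rw [← integral_sub ((memLp_exp_mul _ hf).integrable (by norm_num))
    ((memLp_exp_mul _ hg).integrable (by norm_num))]
  simp only [mul_sub]

lemma eLpNorm_tendsto_zero {ι : Type*} {l : Filter ι} (α : ℝ) {f : ι → ℝ → ℂ}
    (hf : ∀ᶠ i in l, MemLp (f i) 2 angleMeasure)
    (h : Tendsto (fun i => ∑' n, ‖coef α (f i) n‖ ^ 2) l (𝓝 0)) :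
    Tendsto (fun i => eLpNorm (f i) 2 angleMeasure) l (𝓝 0) := by
  have h2 : Tendsto (fun i => ENNReal.ofReal
      (((2 * Real.pi) * ∑' n, ‖coef α (f i) n‖ ^ 2) ^ (2 : ℝ)⁻¹)) l (𝓝 0) := by
    have := ((h.const_mul (2 * Real.pi)).rpow_const (p := (2 : ℝ)⁻¹) (Or.inr (by norm_num)))
    simpa using ENNReal.tendsto_ofReal this
  refine h2.congr' ?_
  filter_upwards [hf] with i hi
  rw [hi.eLpNorm_eq_integral_rpow_norm (by norm_num) (by norm_num), (hasSum_coef α hi).tsum_eq,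
    mul_inv_cancel_left₀ Real.two_pi_pos.ne']
  simp

lemma laurent_tendsto {q α : ℝ} {b : ℤ → ℂ} (hq : 0 < q) (h1 : Summable fun n => ‖b n‖ ^ 2)
    (h2 : Summable fun n : ℤ => (‖b n‖ * q ^ (n + α : ℝ)) ^ 2) {s : ℝ} (hs : s ∈ Icc q 1)
    {g : ℝ → ℂ} (hg : MemLp g 2 angleMeasure) (hgc : ∀ n, coef α g n = ((s ^ (n + α : ℝ) : ℝ) : ℂ) * b n) :
    Tendsto (fun r : ℝ => eLpNorm (fun t => laurent α b (r, t) - g t) 2 angleMeasure) (𝓝[Ioo q 1] s) (𝓝 0) := by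
  have hF := laurent_automorphic hq h1 h2
  have hmem : ∀ᶠ r in 𝓝[Ioo q 1] s, r ∈ Ioo q 1 := eventually_mem_nhdsWithin
  refine eLpNorm_tendsto_zero α ?_ ?_
  · filter_upwards [hmem] with r hr using (memLp_slice hF hq hr.1 hr.2).sub hg
  have hpow : ∀ x : ℝ, ∀ r ∈ Icc q 1, r ^ x ≤ 1 + q ^ x := by
    intro x r hr
    have hr0 := hq.trans_le hr.1
    rcases le_or_gt 0 x with hx | hx
    · have := Real.rpow_le_one hr0.le hr.2 hx
      have := Real.rpow_nonneg hq.le x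
      linarith
    · have := Real.rpow_le_rpow_of_nonpos hq hr.1 hx.le
      linarith
  have hpow0 : ∀ x : ℝ, ∀ r ∈ Icc q 1, 0 ≤ r ^ x := fun x r hr =>
    Real.rpow_nonneg (hq.le.trans hr.1) x
  have key : Tendsto (fun r : ℝ => ∑' n : ℤ,
      ‖(((r ^ (n + α : ℝ) : ℝ) : ℂ) - ((s ^ (n + α : ℝ) : ℝ) : ℂ)) * b n‖ ^ 2)
      (𝓝[Ioo q 1] s) (𝓝 (∑' n : ℤ, (0 : ℝ))) := by
    refine tendsto_tsum_of_dominated_convergence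
      (bound := fun n : ℤ => 2 * (‖b n‖ ^ 2 + (‖b n‖ * q ^ (n + α : ℝ)) ^ 2))
      ((h1.add h2).mul_left 2) ?_ ?_
    · intro n
      have hc : ContinuousAt (fun r : ℝ => r ^ (n + α : ℝ)) s :=
        Real.continuousAt_rpow_const _ _ (Or.inl (hq.trans_le hs.1).ne')
      have h3 : ContinuousAt (fun r : ℝ =>
          ‖(((r ^ (n + α : ℝ) : ℝ) : ℂ) - ((s ^ (n + α : ℝ) : ℝ) : ℂ)) * b n‖ ^ 2) s := by
        have := Complex.continuous_ofReal.continuousAt.comp hc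
        exact (((this.sub continuousAt_const).mul continuousAt_const).norm).pow 2
      have := h3.tendsto.mono_left (nhdsWithin_le_nhds (s := Ioo q 1))
      simpa using this
    · filter_upwards [hmem] with r hr n
      have hr' := Ioo_subset_Icc_self hr
      rw [Real.norm_of_nonneg (by positivity), norm_mul, ← Complex.ofReal_sub, Complex.norm_real,
        Real.norm_eq_abs]
      set x : ℝ := n + α
      have habs : |r ^ x - s ^ x| ≤ 1 + q ^ x := by
        rw [abs_le]
        constructor <;> linarith [hpow x r hr', hpow x s hs, hpow0 x r hr', hpow0 x s hs]
      calc (|r ^ x - s ^ x| * ‖b n‖) ^ 2 ≤ ((1 + q ^ x) * ‖b n‖) ^ 2 := by gcongr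
        _ ≤ _ := by nlinarith [sq_nonneg (‖b n‖ - ‖b n‖ * q ^ x)]
  rw [tsum_zero] at key
  refine key.congr' ?_
  filter_upwards [hmem] with r hr
  congr 1
  ext n
  rw [coef_sub α (memLp_slice hF hq hr.1 hr.2) hg, coef_laurent hq h1 h2 hr, hgc, sub_mul]

lemma circleMeasure_one_le (q : ℝ) : circleMeasure 1 ≤ boundaryMeasure q :=
  Measure.le_add_right le_rfl

lemma circleMeasure_le (q : ℝ) : circleMeasure q ≤ boundaryMeasure q :=
  Measure.le_add_left le_rfl

lemma ae_circle {q s : ℝ} (hs : circleMeasure s ≤ boundaryMeasure q) {p : ℂ → Prop}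
    (h : ∀ᵐ z ∂boundaryMeasure q, p z) : ∀ᵐ t ∂angleMeasure, p (circleMap 0 s t) :=
  ae_of_ae_map (continuous_circleMap 0 s).aemeasurable (ae_mono hs h)

lemma memLp_circle {q s : ℝ} (hs : circleMeasure s ≤ boundaryMeasure q)
    (u : Lp ℂ 2 (boundaryMeasure q)) : MemLp (fun t => u (circleMap 0 s t)) 2 angleMeasure :=
  ((Lp.memLp u).mono_measure hs).comp_of_map (continuous_circleMap 0 s).aemeasurable

lemma HasBoundaryValue.congr {q s : ℝ} (hs : circleMeasure s ≤ boundaryMeasure q)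
    {F : ℝ × ℝ → ℂ} {l : Filter ℝ} {u v : ℂ → ℂ} (h : HasBoundaryValue F s l u)
    (huv : u =ᵐ[boundaryMeasure q] v) : HasBoundaryValue F s l v := by
  refine Tendsto.congr (fun r => ?_) h
  refine eLpNorm_congr_ae ?_
  filter_upwards [ae_circle hs huv] with t ht
  simp [ht]

lemma HasBoundaryValue.add {q s : ℝ} (hs : circleMeasure s ≤ boundaryMeasure q)
    {F G : ℝ × ℝ → ℂ} {l : Filter ℝ} {u v : Lp ℂ 2 (boundaryMeasure q)}
    (hF : HasBoundaryValue F s l u) (hG : HasBoundaryValue G s l v)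
    (hFm : ∀ᶠ r in l, MemLp (fun t => F (r, t)) 2 angleMeasure)
    (hGm : ∀ᶠ r in l, MemLp (fun t => G (r, t)) 2 angleMeasure) :
    HasBoundaryValue (F + G) s l (u + v : Lp ℂ 2 (boundaryMeasure q)) := by
  refine HasBoundaryValue.congr hs (u := u + v) ?_ (Lp.coeFn_add u v).symm
  have h := Tendsto.add hF hG
  rw [add_zero] at h
  refine tendsto_of_tendsto_of_tendsto_of_le_of_le' tendsto_const_nhds h
    (Eventually.of_forall fun _ => zero_le) ?_
  filter_upwards [hFm, hGm] with r h1 h2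
  refine le_trans (le_of_eq ?_) (eLpNorm_add_le (h1.sub (memLp_circle hs u)).1
    (h2.sub (memLp_circle hs v)).1 (by norm_num))
  congr 1
  ext t
  simp
  ring

lemma HasBoundaryValue.smul {q s : ℝ} (hs : circleMeasure s ≤ boundaryMeasure q)
    {F : ℝ × ℝ → ℂ} {l : Filter ℝ} {u : Lp ℂ 2 (boundaryMeasure q)} (c : ℂ)
    (hF : HasBoundaryValue F s l u) :
    HasBoundaryValue (c • F) s l (c • u : Lp ℂ 2 (boundaryMeasure q)) := by
  refine HasBoundaryValue.congr hs (u := c • u) ?_ (Lp.coeFn_smul c u).symm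
  have h := ENNReal.Tendsto.const_mul (a := ‖c‖ₑ) hF (Or.inr (by simp))
  rw [mul_zero] at h
  refine h.congr fun r => ?_
  rw [← eLpNorm_const_smul]
  congr 1
  ext t
  simp
  ring

lemma eventually_slice_one {q α : ℝ} {F : ℝ × ℝ → ℂ} (hF : IsAutomorphic q α F) (hq : 0 < q)
    (hq1 : q < 1) : ∀ᶠ r in 𝓝[<] (1 : ℝ), MemLp (fun t => F (r, t)) 2 angleMeasure := by
  filter_upwards [Ioo_mem_nhdsLT hq1] with r hr using memLp_slice hF hq hr.1 hr.2

lemma eventually_slice {q α : ℝ} {F : ℝ × ℝ → ℂ} (hF : IsAutomorphic q α F) (hq : 0 < q)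
    (hq1 : q < 1) : ∀ᶠ r in 𝓝[>] q, MemLp (fun t => F (r, t)) 2 angleMeasure := by
  filter_upwards [Ioo_mem_nhdsGT hq1] with r hr using memLp_slice hF hq hr.1 hr.2

/-- The Hardy space `H²_α` of the annulus, as a subspace of `L²(B)`: the boundary values of the
analytic modulus automorphic functions `F` of index `α` having square integrable boundary values
on both boundary circles (taken in the `L²` sense). A multivalued function is restricted to `B` by
means of the branch `0 < t ≤ 2π`, the same for all members of the space. -/
def hardySpace (q α : ℝ) (hq0 : 0 < q) (hq1 : q < 1) :
    Submodule ℂ (Lp ℂ 2 (boundaryMeasure q)) where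
  carrier := {u | ∃ F : ℝ × ℝ → ℂ, IsAutomorphic q α F ∧
    HasBoundaryValue F 1 (𝓝[<] 1) u ∧ HasBoundaryValue F q (𝓝[>] q) u}
  zero_mem' := by
    refine ⟨0, ⟨differentiableOn_const 0, fun _ _ _ _ => by simp⟩, ?_, ?_⟩
    · refine HasBoundaryValue.congr (circleMeasure_one_le q) (u := 0) ?_ (Lp.coeFn_zero _ _ _).symm
      simp [HasBoundaryValue]
    · refine HasBoundaryValue.congr (circleMeasure_le q) (u := 0) ?_ (Lp.coeFn_zero _ _ _).symm
      simp [HasBoundaryValue]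
  add_mem' := by
    rintro u v ⟨F, hF, hF1, hF2⟩ ⟨G, hG, hG1, hG2⟩
    refine ⟨F + G, ⟨hF.analytic.add hG.analytic, fun r t h1 h2 => ?_⟩,
      hF1.add (circleMeasure_one_le q) hG1 (eventually_slice_one hF hq0 hq1)
        (eventually_slice_one hG hq0 hq1),
      hF2.add (circleMeasure_le q) hG2 (eventually_slice hF hq0 hq1)
        (eventually_slice hG hq0 hq1)⟩
    simp only [Pi.add_apply, hF.index r t h1 h2, hG.index r t h1 h2, mul_add]
  smul_mem' := by
    rintro c u ⟨F, hF, hF1, hF2⟩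
    refine ⟨c • F, ⟨hF.analytic.const_smul c, fun r t h1 h2 => ?_⟩,
      hF1.smul (circleMeasure_one_le q) c, hF2.smul (circleMeasure_le q) c⟩
    simp only [Pi.smul_apply, hF.index r t h1 h2, smul_eq_mul, mul_left_comm]

lemma mem_hardySpace_iff {q α : ℝ} (hq0 : 0 < q) (hq1 : q < 1) (u : Lp ℂ 2 (boundaryMeasure q)) :
    u ∈ hardySpace q α hq0 hq1 ↔ ∀ n : ℤ, coef α (fun t => u (circleMap 0 q t)) n =
      ((q ^ (n + α : ℝ) : ℝ) : ℂ) * coef α (fun t => u (circleMap 0 1 t)) n := by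
  constructor
  · rintro ⟨F, hF, hF1, hF2⟩ n
    have l1 := coef_tendsto α (eventually_slice_one hF hq0 hq1)
      (memLp_circle (circleMeasure_one_le q) u) hF1 n
    have l2 := coef_tendsto α (eventually_slice hF hq0 hq1)
      (memLp_circle (circleMeasure_le q) u) hF2 n
    have p : ∀ s ∈ Ioo q 1, ((s ^ (n + α : ℝ) : ℝ) : ℂ) * coef α (fun t => u (circleMap 0 1 t)) n =
        coef α (fun t => F (s, t)) n := by
      intro s hs
      have c1 : Tendsto (fun r : ℝ => ((r ^ (n + α : ℝ) : ℝ) : ℂ)) (𝓝[<] 1) (𝓝 1) := by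
        have : ContinuousAt (fun r : ℝ => ((r ^ (n + α : ℝ) : ℝ) : ℂ)) 1 :=
          Complex.continuous_ofReal.continuousAt.comp
            (Real.continuousAt_rpow_const _ _ (Or.inl one_ne_zero))
        simpa using this.tendsto.mono_left (nhdsWithin_le_nhds (s := Iio 1))
      have a := l1.const_mul (((s ^ (n + α : ℝ) : ℝ) : ℂ))
      have b := c1.mul_const (coef α (fun t => F (s, t)) n)
      rw [one_mul] at b
      refine tendsto_nhds_unique_of_eventuallyEq a b ?_
      filter_upwards [Ioo_mem_nhdsLT hq1] with r hr using coef_slice hF hq0 n hr hs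
    have c2 : Tendsto (fun r : ℝ => ((r ^ (n + α : ℝ) : ℝ) : ℂ)) (𝓝[>] q)
        (𝓝 ((q ^ (n + α : ℝ) : ℝ) : ℂ)) := by
      have : ContinuousAt (fun r : ℝ => ((r ^ (n + α : ℝ) : ℝ) : ℂ)) q :=
        Complex.continuous_ofReal.continuousAt.comp
          (Real.continuousAt_rpow_const _ _ (Or.inl hq0.ne'))
      exact this.tendsto.mono_left (nhdsWithin_le_nhds (s := Ioi q))
    have a := c2.mul_const (coef α (fun t => u (circleMap 0 1 t)) n)
    refine tendsto_nhds_unique_of_eventuallyEq l2 a ?_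
    filter_upwards [Ioo_mem_nhdsGT hq1] with r hr using (p r hr).symm
  · intro h
    set b := coef α (fun t => u (circleMap 0 1 t)) with hb
    have m1 := memLp_circle (circleMeasure_one_le q) u
    have m2 := memLp_circle (circleMeasure_le q) u
    have h1 : Summable fun n => ‖b n‖ ^ 2 := (hasSum_coef α m1).summable
    have h2 : Summable fun n : ℤ => (‖b n‖ * q ^ (n + α : ℝ)) ^ 2 := by
      refine (hasSum_coef α m2).summable.congr fun n => ?_
      rw [h, norm_mul, Complex.norm_real, Real.norm_of_nonneg (Real.rpow_nonneg hq0.le _), mul_comm]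
    refine ⟨laurent α b, laurent_automorphic hq0 h1 h2, ?_, ?_⟩
    · have := laurent_tendsto hq0 h1 h2 (s := 1) ⟨hq1.le, le_rfl⟩ m1 (by simp [hb])
      rwa [nhdsWithin_Ioo_eq_nhdsLT hq1] at this
    · have := laurent_tendsto hq0 h1 h2 (s := q) ⟨le_rfl, hq1.le⟩ m2 h
      rwa [nhdsWithin_Ioo_eq_nhdsGT hq1] at this

lemma continuous_coef_circle {q s : ℝ} (hs : circleMeasure s ≤ boundaryMeasure q) (α : ℝ) (n : ℤ) :
    Continuous fun u : Lp ℂ 2 (boundaryMeasure q) => coef α (fun t => u (circleMap 0 s t)) n := by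
  rw [continuous_iff_continuousAt]
  intro v
  refine coef_tendsto α (Eventually.of_forall fun u => memLp_circle hs u) (memLp_circle hs v) ?_ n
  have h := (Lp.tendsto_Lp_iff_tendsto_eLpNorm' (fi := 𝓝 v)
    (fun u : Lp ℂ 2 (boundaryMeasure q) => u) v).mp tendsto_id
  refine tendsto_of_tendsto_of_tendsto_of_le_of_le tendsto_const_nhds h
    (fun _ => zero_le) fun u => ?_
  refine le_trans (le_of_eq ?_) (eLpNorm_mono_measure _ hs)
  have hm := ((Lp.memLp u).sub (Lp.memLp v)).1.mono_measure hs
  rw [circleMeasure, eLpNorm_map_measure hm (continuous_circleMap 0 s).aemeasurable]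
  rfl

/-- `H²_α` is closed in `L²(B)`, so that the orthogonal projection onto it exists. -/
lemma isClosed_hardySpace (q α : ℝ) (hq0 : 0 < q) (hq1 : q < 1) :
    IsClosed (hardySpace q α hq0 hq1 : Set (Lp ℂ 2 (boundaryMeasure q))) := by
  have : (hardySpace q α hq0 hq1 : Set (Lp ℂ 2 (boundaryMeasure q))) =
      ⋂ n : ℤ, {u | coef α (fun t => u (circleMap 0 q t)) n =
      ((q ^ (n + α : ℝ) : ℝ) : ℂ) * coef α (fun t => u (circleMap 0 1 t)) n} := by
    ext u
    simp [mem_hardySpace_iff]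
  rw [this]
  exact isClosed_iInter fun n => isClosed_eq (continuous_coef_circle (circleMeasure_le q) α n)
    (continuous_const.mul (continuous_coef_circle (circleMeasure_one_le q) α n))

instance completeSpace_hardySpace (q α : ℝ) (hq0 : 0 < q) (hq1 : q < 1) :
    CompleteSpace (hardySpace q α hq0 hq1) :=
  (isClosed_hardySpace q α hq0 hq1).completeSpace_coe

/-- Multiplication by `φ ∈ L^∞(B)` on `L²(B)`. -/
def multiplication (q : ℝ) (φ : ℂ → ℝ) (hφ : MemLp φ ∞ (boundaryMeasure q)) :
    Lp ℂ 2 (boundaryMeasure q) →L[ℂ] Lp ℂ 2 (boundaryMeasure q) :=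
  (ContinuousLinearMap.mul ℂ ℂ).holderL (boundaryMeasure q) ∞ 2 2 (hφ.ofReal (K := ℂ)).toLp

lemma multiplication_ae (q : ℝ) (φ : ℂ → ℝ) (hφ : MemLp φ ∞ (boundaryMeasure q))
    (u : Lp ℂ 2 (boundaryMeasure q)) :
    multiplication q φ hφ u =ᵐ[boundaryMeasure q] fun z => (φ z : ℂ) * u z := by
  refine (ContinuousLinearMap.coeFn_holder _ _ _).trans ?_
  filter_upwards [(hφ.ofReal (K := ℂ)).coeFn_toLp] with z hz
  rw [hz]
  simp

/-- The Toeplitz operator `T f = P (φ f)` on `H²_α`, where `P` is the orthogonal projection of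
`L²(B)` onto `H²_α`. -/
def toeplitz (q α : ℝ) (hq0 : 0 < q) (hq1 : q < 1) (φ : ℂ → ℝ)
    (hφ : MemLp φ ∞ (boundaryMeasure q)) :
    hardySpace q α hq0 hq1 →L[ℂ] hardySpace q α hq0 hq1 :=
  (hardySpace q α hq0 hq1).orthogonalProjectionOnto ∘L multiplication q φ hφ ∘L
    (hardySpace q α hq0 hq1).subtypeL

/-- `∫ f dμ = -∞` for an extended real valued `f`: the integral of the positive part is finite and
that of the negative part is infinite. -/
def IntegralEqBot {X : Type*} [MeasurableSpace X] (f : X → EReal) (μ : Measure X) : Prop :=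
  ∫⁻ x, (f x).toENNReal ∂μ ≠ ∞ ∧ ∫⁻ x, (-f x).toENNReal ∂μ = ∞

/-- `∫_B log |φ - c| dμ = -∞`, where `log 0 = -∞`. -/
def LogIntegralEqBot (q : ℝ) (φ : ℂ → ℝ) (c : ℝ) : Prop :=
  IntegralEqBot (fun z => ENNReal.log ‖φ z - c‖ₑ) (boundaryMeasure q)

end AnnulusToeplitz

end

/-!
Suppose `u ∈ H²_α` satisfies `|u|² |φ - l| = 1` on the boundary and `w / u ∈ H²_0` for every
`w ∈ H²_α`. Since `φ - l` has opposite signs on the two circles, the inner product of `(φ - l) u`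
with `w` is, up to sign, the difference of the integrals of `w / u` over the two circles, which is
`0` because both are the zeroth Laurent coefficient. Hence `(φ - l) u` is orthogonal to `H²_α`, and
`l` is an eigenvalue.

Such a `u` has the form `z ^ (α + k) * exp H` with `Re H` prescribed. A real function on the
boundary is the real part of such an `H` exactly when its means over the two circles agree, so `u`
exists if `∫_{B_1} log |φ - l| - ∫_{B_q} log |φ - l| = 4π log q (α + k)` for some integer `k`. The
left-hand side is continuous in `l ∈ (m, M)`, and divergence of one of the logarithmic integrals
makes it unbounded at an endpoint, so the equation is solvable for infinitely many `l`.

To construct `H`, approximate the prescribed real part by polynomials in `z` and `conj z`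
(Stone–Weierstrass); on the boundary their real parts are `Re h + κ log |z|` with `h` a Laurent
polynomial. Equality of the means forces `κ → 0`, and the functions `h` converge in `L²` because an
element of `H²_0` with real mean is controlled by its real part.
-/

namespace AnnulusToeplitz

/-! ### Logarithmic integrals -/

lemma infinite_setOf_eq_mul_add_intCast {X : Type*} [TopologicalSpace X] {D : X → ℝ} {I : Set X}
    {F : Filter X} [F.NeBot] (hI : IsPreconnected I) (hF : F ≤ 𝓟 I) (hD : ContinuousOn D I)
    (hT : Tendsto D F atBot) {c : ℝ} (hc : c ≠ 0) (α : ℝ) :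
    {l | l ∈ I ∧ ∃ k : ℤ, D l = c * (α + k)}.Infinite := by
  obtain ⟨a, ha⟩ := Filter.nonempty_of_mem (le_principal_iff.mp hF)
  have hIic : Iic (D a) ⊆ D '' I := hI.intermediate_value_Iic ha hF hD hT
  refine Infinite.of_image D (infinite_of_forall_exists_lt fun b => ?_)
  obtain ⟨k, hk⟩ : ∃ k : ℤ, c * (α + k) < min b (D a) := by
    rcases hc.lt_or_gt with hneg | hpos
    · obtain ⟨k, hk⟩ := exists_int_gt (min b (D a) / c - α)
      exact ⟨k, by rw [mul_comm, ← div_lt_iff_of_neg hneg]; linarith⟩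
    · obtain ⟨k, hk⟩ := exists_int_lt (min b (D a) / c - α)
      exact ⟨k, by rw [mul_comm, ← lt_div_iff₀ hpos]; linarith⟩
  obtain ⟨l, hl, hlk⟩ := hIic (hk.le.trans (min_le_right _ _))
  exact ⟨_, mem_image_of_mem D ⟨hl, k, hlk⟩, hlk.trans_lt (hk.trans_le (min_le_left _ _))⟩

section LogIntegral

variable {X : Type*} [MeasurableSpace X] {μ ν : Measure X} {f : X → ℝ} {l c d m M : ℝ}

lemma abs_log_le_of_mem_Icc {x a b : ℝ} (ha : 0 < a) (hx : x ∈ Icc a b) :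
    |Real.log x| ≤ max |Real.log a| |Real.log b| :=
  abs_le_max_abs_abs (Real.log_le_log ha hx.1) (Real.log_le_log (ha.trans_le hx.1) hx.2)

lemma ae_abs_log_abs_sub_le (hf : MemLp f ∞ μ) (hd : 0 < d) (h : ∀ᵐ x ∂μ, d ≤ |f x - l|) :
    ∀ᵐ x ∂μ, |Real.log (|f x - l|)| ≤ max |Real.log d| |Real.log (lpNorm f ∞ μ + |l|)| := by
  filter_upwards [h, ae_le_lpNorm_exponent_top hf] with x hx hfx
  exact abs_log_le_of_mem_Icc hd ⟨hx, (abs_sub _ _).trans (by gcongr; exact hfx)⟩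

lemma memLp_log_abs_sub (hf : MemLp f ∞ μ) (hd : 0 < d) (h : ∀ᵐ x ∂μ, d ≤ |f x - l|) :
    MemLp (fun x => Real.log |f x - l|) ∞ μ :=
  memLp_top_of_bound (hf.1.aemeasurable.sub_const l).abs.log.aestronglyMeasurable _
    (ae_abs_log_abs_sub_le hf hd h)

lemma min_le_abs_sub_of_notMem_Ioo {y : ℝ} (hy : y ∉ Ioo m M) : min (l - m) (M - l) ≤ |y - l| := by
  rcases le_or_gt y m with hym | hmy
  · exact (min_le_left _ _).trans (le_abs.mpr (.inr (by linarith)))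
  · have hMy : M ≤ y := not_lt.mp fun hyM => hy ⟨hmy, hyM⟩
    exact (min_le_right _ _).trans (le_abs.mpr (.inl (by linarith)))

lemma memLp_log_abs_sub_of_notMem_Ioo (hf : MemLp f ∞ μ) (hsep : ∀ᵐ x ∂μ, f x ∉ Ioo m M)
    (hl : l ∈ Ioo m M) : MemLp (fun x => Real.log |f x - l|) ∞ μ :=
  memLp_log_abs_sub hf (lt_min (sub_pos.mpr hl.1) (sub_pos.mpr hl.2))
    (hsep.mono fun _ => min_le_abs_sub_of_notMem_Ioo)

lemma toENNReal_neg_log_enorm_sub {x : ℝ} (h : x ≠ c) :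
    (-ENNReal.log ‖x - c‖ₑ).toENNReal = ENNReal.ofReal (-Real.log |x - c|) := by
  rw [← ofReal_norm, Real.norm_eq_abs, ENNReal.log_ofReal_of_pos (abs_pos.mpr (sub_ne_zero.mpr h)),
    ← EReal.coe_neg, EReal.toENNReal_of_ne_top (EReal.coe_ne_top _), EReal.toReal_coe]

lemma tendsto_lintegral_neg_log_enorm_sub (hf : AEMeasurable f μ)
    (h : ∫⁻ x, (-ENNReal.log ‖f x - c‖ₑ).toENNReal ∂μ = ∞) :
    Tendsto (fun l => ∫⁻ x, (-ENNReal.log ‖f x - l‖ₑ).toENNReal ∂μ) (𝓝 c) (𝓝 ∞) := by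
  refine tendsto_of_seq_tendsto fun l hl => ?_
  have hcont : Continuous fun y : ℝ => (-ENNReal.log ‖y‖ₑ).toENNReal := by fun_prop
  have hlim (x : X) : Tendsto (fun k => (-ENNReal.log ‖f x - l k‖ₑ).toENNReal) atTop
      (𝓝 (-ENNReal.log ‖f x - c‖ₑ).toENNReal) :=
    (hcont.tendsto _).comp (hl.const_sub (f x))
  refine tendsto_of_le_liminf_of_limsup_le ?_ le_top
  calc ∞ = ∫⁻ x, liminf (fun k => (-ENNReal.log ‖f x - l k‖ₑ).toENNReal) atTop ∂μ := by
        simp only [fun x => (hlim x).liminf_eq, h]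
    _ ≤ _ := lintegral_liminf_le' fun k =>
        hcont.measurable.comp_aemeasurable (hf.sub_const (l k))

variable [IsFiniteMeasure μ]

lemma lintegral_neg_log_enorm_sub_ne_top (hf : MemLp f ∞ μ) (hd : 0 < d)
    (h : ∀ᵐ x ∂μ, d ≤ |f x - c|) :
    ∫⁻ x, (-ENNReal.log ‖f x - c‖ₑ).toENNReal ∂μ ≠ ∞ := by
  have hne : ∀ᵐ x ∂μ, f x ≠ c := by
    filter_upwards [h] with x hx hxc
    simp [hxc, hd.not_ge] at hx
  rw [lintegral_congr_ae (hne.mono fun x => toENNReal_neg_log_enorm_sub)]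
  exact ((memLp_log_abs_sub hf hd h).integrable le_top).neg.lintegral_lt_top.ne

lemma continuousAt_integral_log_abs_sub (hf : MemLp f ∞ μ) (hd : 0 < d)
    (h : ∀ᵐ x ∂μ, d ≤ |f x - l|) :
    ContinuousAt (fun l => ∫ x, Real.log |f x - l| ∂μ) l := by
  have hnear : ∀ᶠ k in 𝓝 l, |k - l| < d / 2 := Metric.ball_mem_nhds l (half_pos hd)
  have hbdd : ∀ᶠ k in 𝓝 l, |k| < |l| + 1 :=
    (continuous_abs.tendsto l).eventually_lt_const (lt_add_one _)
  refine continuousAt_of_dominated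
    (bound := fun _ => max |Real.log (d / 2)| |Real.log (lpNorm f ∞ μ + (|l| + 1))|)
    (.of_forall fun k => (hf.1.aemeasurable.sub_const k).abs.log.aestronglyMeasurable) ?_
    (integrable_const _) ?_
  · filter_upwards [hnear, hbdd] with k hkl hk
    filter_upwards [h, ae_le_lpNorm_exponent_top hf] with x hx hfx
    refine abs_log_le_of_mem_Icc (half_pos hd) ⟨?_, (abs_sub _ _).trans (add_le_add hfx hk.le)⟩
    linarith [abs_sub_le (f x) k l]
  · filter_upwards [h] with x hx
    exact ContinuousAt.log (by fun_prop) (hd.trans_le hx).ne'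

lemma continuousOn_integral_log_abs_sub (hf : MemLp f ∞ μ) (hsep : ∀ᵐ x ∂μ, f x ∉ Ioo m M) :
    ContinuousOn (fun l => ∫ x, Real.log |f x - l| ∂μ) (Ioo m M) := fun _ hl =>
  (continuousAt_integral_log_abs_sub hf (lt_min (sub_pos.mpr hl.1) (sub_pos.mpr hl.2))
    (hsep.mono fun _ => min_le_abs_sub_of_notMem_Ioo)).continuousWithinAt

lemma tendsto_integral_log_abs_sub_atBot (hf : MemLp f ∞ μ) (hsep : ∀ᵐ x ∂μ, f x ∉ Ioo m M)
    (hc : ∫⁻ x, (-ENNReal.log ‖f x - c‖ₑ).toENNReal ∂μ = ∞) :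
    Tendsto (fun l => ∫ x, Real.log |f x - l| ∂μ) (𝓝[Ioo m M] c) atBot := by
  set C := lpNorm f ∞ μ + (|c| + 1)
  have hC : 0 ≤ C := add_nonneg lpNorm_nonneg (by positivity)
  refine tendsto_atBot.mpr fun b => ?_
  have hlarge := ((tendsto_lintegral_neg_log_enorm_sub hf.1.aemeasurable hc).mono_left
    (nhdsWithin_le_nhds (s := Ioo m M))).eventually_const_lt
      (ENNReal.ofReal_lt_top (r := C * μ.real univ - b))
  have hnear : ∀ᶠ l in 𝓝[Ioo m M] c, |l| < |c| + 1 :=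
    ((continuous_abs.tendsto c).eventually_lt_const (lt_add_one _)).filter_mono nhdsWithin_le_nhds
  filter_upwards [hlarge, hnear, self_mem_nhdsWithin] with l hlt hlc hl
  have hint : Integrable (fun x => Real.log |f x - l|) μ :=
    (memLp_log_abs_sub_of_notMem_Ioo hf hsep hl).integrable le_top
  have hle : ∀ᵐ x ∂μ, Real.log |f x - l| ≤ C := by
    filter_upwards [ae_le_lpNorm_exponent_top hf] with x hx
    exact (Real.log_le_self (abs_nonneg _)).trans ((abs_sub _ _).trans (add_le_add hx hlc.le))
  have hne : ∀ᵐ x ∂μ, f x ≠ l := hsep.mono fun x hx hxl => hx (hxl ▸ hl)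
  have hlt' : ENNReal.ofReal (C * μ.real univ - b) <
      ENNReal.ofReal (∫ x, (C - Real.log |f x - l|) ∂μ) := by
    rw [ofReal_integral_eq_lintegral_ofReal (f := fun x => C - Real.log |f x - l|)
      ((integrable_const C).sub hint) (hle.mono fun x => sub_nonneg.mpr)]
    refine hlt.trans_le (lintegral_mono_ae (hne.mono fun x hx => ?_))
    rw [toENNReal_neg_log_enorm_sub hx]
    exact ENNReal.ofReal_le_ofReal (by linarith)
  have hreal := (ENNReal.ofReal_lt_ofReal_iff'.mp hlt').1
  rw [integral_sub (integrable_const C) hint, integral_const, smul_eq_mul] at hreal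
  linarith

lemma infinite_setOf_integral_log_sub_eq_of_lintegral_eq_top [IsFiniteMeasure ν]
    [(𝓝[Ioo m M] c).NeBot] (hμ : MemLp f ∞ μ) (hν : MemLp f ∞ ν)
    (hsepμ : ∀ᵐ x ∂μ, f x ∉ Ioo m M) (hsepν : ∀ᵐ x ∂ν, f x ∉ Ioo m M) (hd : 0 < d)
    (hcν : ∀ᵐ x ∂ν, d ≤ |f x - c|)
    (hc : ∫⁻ x, (-ENNReal.log ‖f x - c‖ₑ).toENNReal ∂(μ + ν) = ∞) {r : ℝ} (hr : r ≠ 0) (α : ℝ) :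
    {l | l ∈ Ioo m M ∧ ∃ k : ℤ, ∫ x, Real.log |f x - l| ∂μ - ∫ x, Real.log |f x - l| ∂ν =
      r * (α + k)}.Infinite := by
  rw [lintegral_add_measure, ENNReal.add_eq_top,
    or_iff_left (lintegral_neg_log_enorm_sub_ne_top hν hd hcν)] at hc
  refine infinite_setOf_eq_mul_add_intCast (F := 𝓝[Ioo m M] c) isPreconnected_Ioo inf_le_right
    ((continuousOn_integral_log_abs_sub hμ hsepμ).sub
      (continuousOn_integral_log_abs_sub hν hsepν)) ?_ hr α
  simp only [sub_eq_add_neg]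
  exact (tendsto_integral_log_abs_sub_atBot hμ hsepμ hc).atBot_add
    ((continuousAt_integral_log_abs_sub hν hd hcν).tendsto.mono_left nhdsWithin_le_nhds).neg

lemma infinite_setOf_integral_log_sub_eq [IsFiniteMeasure ν] (hmM : m < M) (hμ : MemLp f ∞ μ)
    (hν : MemLp f ∞ ν) (hM : ∀ᵐ x ∂μ, M ≤ f x) (hm : ∀ᵐ x ∂ν, f x ≤ m)
    (hlog : ∫⁻ x, (-ENNReal.log ‖f x - M‖ₑ).toENNReal ∂(μ + ν) = ∞ ∨
      ∫⁻ x, (-ENNReal.log ‖f x - m‖ₑ).toENNReal ∂(μ + ν) = ∞) {r : ℝ} (hr : r ≠ 0) (α : ℝ) :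
    {l | l ∈ Ioo m M ∧ ∃ k : ℤ, ∫ x, Real.log |f x - l| ∂μ - ∫ x, Real.log |f x - l| ∂ν =
      r * (α + k)}.Infinite := by
  have hsepμ : ∀ᵐ x ∂μ, f x ∉ Ioo m M := hM.mono fun x hx h => hx.not_gt h.2
  have hsepν : ∀ᵐ x ∂ν, f x ∉ Ioo m M := hm.mono fun x hx h => hx.not_gt h.1
  rcases hlog with hlog | hlog
  · have := right_nhdsWithin_Ioo_neBot hmM
    refine infinite_setOf_integral_log_sub_eq_of_lintegral_eq_top hμ hν hsepμ hsepν
      (sub_pos.mpr hmM) (hm.mono fun x hx => ?_) hlog hr α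
    exact le_abs.mpr (.inr (by linarith))
  · have := left_nhdsWithin_Ioo_neBot hmM
    rw [add_comm] at hlog
    refine (infinite_setOf_integral_log_sub_eq_of_lintegral_eq_top hν hμ hsepν hsepμ
      (sub_pos.mpr hmM) (hM.mono fun x hx => ?_) hlog (neg_ne_zero.mpr hr) α).mono ?_
    · exact le_abs.mpr (.inl (by linarith))
    · exact fun l ⟨hl, k, hk⟩ => ⟨hl, k, by linarith⟩

end LogIntegral

section EssSup

variable {X : Type*} [MeasurableSpace X] {μ : Measure X} {f : X → ℝ}

lemma ae_le_essSup_of_memLp_top (hf : MemLp f ∞ μ) : ∀ᵐ x ∂μ, f x ≤ essSup f μ :=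
  ae_le_essSup ⟨lpNorm f ∞ μ, eventually_map.mpr <|
    (ae_le_lpNorm_exponent_top hf).mono fun _ hx => (le_abs_self _).trans hx⟩

lemma ae_essInf_le_of_memLp_top (hf : MemLp f ∞ μ) : ∀ᵐ x ∂μ, essInf f μ ≤ f x :=
  ae_essInf_le ⟨-lpNorm f ∞ μ, eventually_map.mpr <|
    (ae_le_lpNorm_exponent_top hf).mono fun _ hx => neg_le_of_abs_le hx⟩

end EssSup

/-! ### Integration over the boundary circles -/

instance isFiniteMeasure_circleMeasure (s : ℝ) : IsFiniteMeasure (circleMeasure s) :=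
  inferInstanceAs (IsFiniteMeasure (Measure.map _ _))

instance isFiniteMeasure_boundaryMeasure (q : ℝ) : IsFiniteMeasure (boundaryMeasure q) :=
  inferInstanceAs (IsFiniteMeasure (_ + _))

lemma ae_boundaryMeasure_iff {q : ℝ} {p : ℂ → Prop} : (∀ᵐ z ∂boundaryMeasure q, p z) ↔
    (∀ᵐ z ∂circleMeasure 1, p z) ∧ ∀ᵐ z ∂circleMeasure q, p z :=
  ae_add_measure_iff

lemma ae_norm_eq_circleMeasure {s : ℝ} (hs : 0 ≤ s) : ∀ᵐ z ∂circleMeasure s, ‖z‖ = s :=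
  (ae_map_iff (continuous_circleMap 0 s).aemeasurable
    (measurableSet_eq_fun measurable_norm measurable_const)).mpr
      (Eventually.of_forall fun t => by simp [abs_of_nonneg hs])

/-- The boundary of the annulus, as a set. -/
def boundary (q : ℝ) : Set ℂ := Metric.sphere 0 1 ∪ Metric.sphere 0 q

lemma mem_boundary_iff {q : ℝ} {z : ℂ} : z ∈ boundary q ↔ ‖z‖ = 1 ∨ ‖z‖ = q := by
  simp [boundary]

instance compactSpace_boundary (q : ℝ) : CompactSpace (boundary q) :=
  isCompact_iff_compactSpace.mp ((isCompact_sphere 0 1).union (isCompact_sphere 0 q))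

lemma ne_zero_of_mem_boundary {q : ℝ} {z : ℂ} (hq0 : 0 < q) (hz : z ∈ boundary q) : z ≠ 0 := by
  rw [← norm_pos_iff]
  rcases mem_boundary_iff.mp hz with h | h <;> simp [h, hq0]

lemma ae_mem_boundary {q : ℝ} (hq0 : 0 < q) : ∀ᵐ z ∂boundaryMeasure q, z ∈ boundary q :=
  ae_boundaryMeasure_iff.mpr
    ⟨(ae_norm_eq_circleMeasure zero_le_one).mono fun _ h => mem_boundary_iff.mpr (.inl h),
      (ae_norm_eq_circleMeasure hq0.le).mono fun _ h => mem_boundary_iff.mpr (.inr h)⟩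

lemma integral_circleMeasure {s : ℝ} {f : ℂ → ℂ} (hf : AEStronglyMeasurable f (circleMeasure s)) :
    ∫ z, f z ∂circleMeasure s = ∫ t, f (circleMap 0 s t) ∂angleMeasure :=
  integral_map (continuous_circleMap 0 s).aemeasurable hf

lemma memLp_comp_circleMap {q s : ℝ} (hs : circleMeasure s ≤ boundaryMeasure q) {p : ℝ≥0∞}
    {f : ℂ → ℂ} (hf : MemLp f p (boundaryMeasure q)) :
    MemLp (fun t => f (circleMap 0 s t)) p angleMeasure :=
  (hf.mono_measure hs).comp_of_map (continuous_circleMap 0 s).aemeasurable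

lemma eLpNorm_comp_circleMap_le {q s : ℝ} (hs : circleMeasure s ≤ boundaryMeasure q) {p : ℝ≥0∞}
    {f : ℂ → ℂ} (hf : AEStronglyMeasurable f (boundaryMeasure q)) :
    eLpNorm (fun t => f (circleMap 0 s t)) p angleMeasure ≤ eLpNorm f p (boundaryMeasure q) := by
  refine le_trans (le_of_eq ?_) (eLpNorm_mono_measure f hs)
  exact (eLpNorm_map_measure (hf.mono_measure hs) (continuous_circleMap 0 s).aemeasurable).symm

lemma coef_congr_ae {α : ℝ} {f g : ℝ → ℂ} (h : f =ᵐ[angleMeasure] g) (n : ℤ) :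
    coef α f n = coef α g n := by
  rw [coef_eq, coef_eq]
  congr 1
  exact integral_congr_ae (h.mono fun t ht => by simp only [ht])

lemma coef_const_mul (α : ℝ) (c : ℂ) (f : ℝ → ℂ) (n : ℤ) :
    coef α (fun t => c * f t) n = c * coef α f n := by
  simp only [coef_eq, mul_left_comm _ c, integral_const_mul, mul_smul_comm]

lemma coef_add {α : ℝ} {f g : ℝ → ℂ} (hf : MemLp f 2 angleMeasure) (hg : MemLp g 2 angleMeasure)
    (n : ℤ) : coef α (fun t => f t + g t) n = coef α f n + coef α g n := by
  have h := coef_sub α (hf.add hg) hg n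
  simp only [Pi.add_apply, add_sub_cancel_right] at h
  rw [h]
  exact (sub_add_cancel _ _).symm

lemma coef_conj (f : ℝ → ℂ) (n : ℤ) :
    coef 0 (fun t => (starRingEnd ℂ) (f t)) n = (starRingEnd ℂ) (coef 0 f (-n)) := by
  rw [coef_eq, coef_eq, Complex.real_smul, Complex.real_smul, map_mul, Complex.conj_ofReal,
    ← integral_conj]
  congr 2
  ext t
  rw [map_mul, ← Complex.exp_conj]
  simp

lemma coef_add_exp_mul (α β : ℝ) (f : ℝ → ℂ) (n : ℤ) :
    coef (α + β) (fun t => Complex.exp (β * t * Complex.I) * f t) n = coef α f n := by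
  simp only [coef_eq, ← mul_assoc, ← Complex.exp_add]
  congr 4 with t
  congr 2
  push_cast
  ring

lemma coef_add_intCast (α : ℝ) (k : ℤ) (f : ℝ → ℂ) (n : ℤ) :
    coef (α + k) f n = coef α f (n + k) := by
  simp only [coef_eq]
  congr 4 with t
  push_cast
  ring_nf

lemma coef_zero_one (n : ℤ) : coef 0 (fun _ => 1) n = if n = 0 then 1 else 0 := by
  have h := integral_exp_int (-n)
  simp only [neg_eq_zero, Int.cast_neg, neg_mul] at h
  simp only [coef_eq, Complex.ofReal_zero, add_zero, mul_one, h]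
  split_ifs
  · rw [Complex.real_smul, ← Complex.ofReal_ofNat, ← Complex.ofReal_mul, ← Complex.ofReal_mul,
      one_div_mul_cancel Real.two_pi_pos.ne', Complex.ofReal_one]
  · rw [smul_zero]

/-! ### Boundary values of Hardy space functions -/

lemma tendsto_eLpNorm_of_dominated {X E : Type*} [MeasurableSpace X] [NormedAddCommGroup E]
    {μ : Measure X} {p : ℝ≥0∞} (hp0 : p ≠ 0) (hp : p ≠ ∞) {f : ℕ → X → E} {g : X → E} {b : X → ℝ}
    (hf : ∀ i, AEStronglyMeasurable (f i) μ) (hb : MemLp b p μ)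
    (hle : ∀ i, ∀ᵐ x ∂μ, ‖f i x‖ ≤ b x)
    (h : ∀ᵐ x ∂μ, Tendsto (fun i => f i x) atTop (𝓝 (g x))) :
    Tendsto (fun i => eLpNorm (f i - g) p μ) atTop (𝓝 0) := by
  have hg : AEStronglyMeasurable g μ := aestronglyMeasurable_of_tendsto_ae atTop hf h
  have hpos : 0 < p.toReal := ENNReal.toReal_pos hp0 hp
  have hlim : Tendsto (fun i => ∫⁻ x, ‖f i x - g x‖ₑ ^ p.toReal ∂μ) atTop (𝓝 (∫⁻ _, 0 ∂μ)) := by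
    refine tendsto_lintegral_of_dominated_convergence' (fun x => ‖2 * b x‖ₑ ^ p.toReal)
      (fun i => ((hf i).sub hg).enorm.pow_const _) (fun i => ?_)
      (lintegral_rpow_enorm_lt_top_of_eLpNorm_lt_top hp0 hp (hb.const_mul 2).2).ne ?_
    · filter_upwards [ae_all_iff.mpr hle, h] with x hx hlim
      have hgx : ‖g x‖ ≤ b x := le_of_tendsto' hlim.norm hx
      gcongr
      rw [enorm_le_iff_norm_le, Real.norm_eq_abs]
      calc ‖f i x - g x‖ ≤ ‖f i x‖ + ‖g x‖ := norm_sub_le _ _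
        _ ≤ 2 * b x := by linarith [hx i]
        _ ≤ |2 * b x| := le_abs_self _
    · filter_upwards [h] with x hx
      have h0 : Tendsto (fun i => ‖f i x - g x‖ₑ) atTop (𝓝 0) := by
        simpa using (hx.sub_const (g x)).enorm
      simpa [hpos] using h0.ennrpow_const p.toReal
  simp only [eLpNorm_eq_lintegral_rpow_enorm_toReal hp0 hp]
  simpa [hpos] using hlim.ennrpow_const (1 / p.toReal)

variable {q α : ℝ} {f g : ℂ → ℂ}

/-- `f` represents an element of the Hardy space `H²_α` of the annulus, in the form of the relation
between the Fourier coefficients of `f` on the two boundary circles which characterizes the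
boundary values of a Laurent series `∑ b_n z ^ (n + α)`. -/
structure MemHardy (q α : ℝ) (f : ℂ → ℂ) : Prop where
  memLp : MemLp f 2 (boundaryMeasure q)
  coef_circle : ∀ n : ℤ, coef α (fun t => f (circleMap 0 q t)) n =
    ((q ^ (n + α : ℝ) : ℝ) : ℂ) * coef α (fun t => f (circleMap 0 1 t)) n

namespace MemHardy

lemma congr_ae (hf : MemHardy q α f) (h : f =ᵐ[boundaryMeasure q] g) : MemHardy q α g where
  memLp := hf.memLp.ae_eq h
  coef_circle n := by
    have hcoef {s : ℝ} (hs : circleMeasure s ≤ boundaryMeasure q) :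
        coef α (fun t => f (circleMap 0 s t)) n = coef α (fun t => g (circleMap 0 s t)) n :=
      coef_congr_ae (ae_circle (p := fun z => f z = g z) hs h) n
    rw [← hcoef (circleMeasure_le q), ← hcoef (circleMeasure_one_le q), hf.coef_circle]

lemma coeFn_iff (hq0 : 0 < q) (hq1 : q < 1) {u : Lp ℂ 2 (boundaryMeasure q)} :
    MemHardy q α u ↔ u ∈ hardySpace q α hq0 hq1 :=
  ⟨fun h => (mem_hardySpace_iff hq0 hq1 u).mpr h.coef_circle,
    fun h => ⟨Lp.memLp u, (mem_hardySpace_iff hq0 hq1 u).mp h⟩⟩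

lemma toLp_mem_hardySpace (hq0 : 0 < q) (hq1 : q < 1) (hf : MemHardy q α f) :
    hf.memLp.toLp f ∈ hardySpace q α hq0 hq1 :=
  (coeFn_iff hq0 hq1).mp (hf.congr_ae hf.memLp.coeFn_toLp.symm)

lemma const_mul (hf : MemHardy q α f) (c : ℂ) : MemHardy q α (fun z => c * f z) where
  memLp := hf.memLp.const_mul c
  coef_circle n := by rw [coef_const_mul, coef_const_mul, hf.coef_circle, mul_left_comm]

lemma add (hf : MemHardy q α f) (hg : MemHardy q α g) : MemHardy q α (fun z => f z + g z) where
  memLp := hf.memLp.add hg.memLp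
  coef_circle n := by
    have h1 := circleMeasure_one_le q
    have h2 := circleMeasure_le q
    rw [coef_add (memLp_comp_circleMap h2 hf.memLp) (memLp_comp_circleMap h2 hg.memLp),
      coef_add (memLp_comp_circleMap h1 hf.memLp) (memLp_comp_circleMap h1 hg.memLp),
      hf.coef_circle, hg.coef_circle, mul_add]

lemma of_tendsto {f : ℕ → ℂ → ℂ} (hf : ∀ i, MemHardy q α (f i))
    (hg : MemLp g 2 (boundaryMeasure q))
    (h : Tendsto (fun i => eLpNorm (f i - g) 2 (boundaryMeasure q)) atTop (𝓝 0)) :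
    MemHardy q α g where
  memLp := hg
  coef_circle n := by
    have hcoef {s : ℝ} (hs : circleMeasure s ≤ boundaryMeasure q) :
        Tendsto (fun i => coef α (fun t => f i (circleMap 0 s t)) n) atTop
          (𝓝 (coef α (fun t => g (circleMap 0 s t)) n)) := by
      refine coef_tendsto α (f := fun i t => f i (circleMap 0 s t))
        (.of_forall fun i => memLp_comp_circleMap hs (hf i).memLp)
        (memLp_comp_circleMap hs hg) ?_ n
      exact tendsto_of_tendsto_of_tendsto_of_le_of_le tendsto_const_nhds h (fun _ => zero_le)
        fun i => eLpNorm_comp_circleMap_le (f := f i - g) hs ((hf i).memLp.sub hg).1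
    refine tendsto_nhds_unique (hcoef (circleMeasure_le q)) ?_
    exact ((hcoef (circleMeasure_one_le q)).const_mul _).congr fun i => ((hf i).coef_circle n).symm

lemma one : MemHardy q 0 (fun _ => 1) where
  memLp := memLp_const 1
  coef_circle n := by
    rw [coef_zero_one]
    split_ifs with hn <;> simp [hn]

lemma integral_eq (hf : MemHardy q 0 f) :
    ∫ z, f z ∂circleMeasure q = ∫ z, f z ∂circleMeasure 1 := by
  have h := hf.coef_circle 0
  simp only [coef_eq, Int.cast_zero, Complex.ofReal_zero, add_zero, zero_mul,
    neg_zero, Complex.exp_zero, one_mul, Real.rpow_zero, Complex.ofReal_one] at h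
  rw [integral_circleMeasure (hf.memLp.1.mono_measure (circleMeasure_le q)),
    integral_circleMeasure (hf.memLp.1.mono_measure (circleMeasure_one_le q))]
  exact smul_right_injective ℂ (one_div_ne_zero Real.two_pi_pos.ne') h

lemma add_intCast_iff (k : ℤ) : MemHardy q (α + k) f ↔ MemHardy q α f := by
  refine ⟨fun hf => ⟨hf.memLp, fun n => ?_⟩, fun hf => ⟨hf.memLp, fun n => ?_⟩⟩
  · have h := hf.coef_circle (n - k)
    rw [coef_add_intCast, coef_add_intCast, sub_add_cancel] at h
    rw [h]
    push_cast
    ring_nf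
  · rw [coef_add_intCast, coef_add_intCast, hf.coef_circle]
    push_cast
    ring_nf

end MemHardy

/-- The branch of the logarithm whose imaginary part lies in `(0, 2π]`, as in the definition of
boundary values. -/
noncomputable def branchLog (z : ℂ) : ℂ := Complex.log (-z) + Real.pi * Complex.I

lemma measurable_branchLog : Measurable branchLog :=
  (Complex.measurable_log.comp measurable_neg).add_const _

lemma re_branchLog (z : ℂ) : (branchLog z).re = Real.log ‖z‖ := by
  simp [branchLog, Complex.log_re]

lemma branchLog_circleMap {s t : ℝ} (hs : 0 < s) (ht : t ∈ Ioc 0 (2 * Real.pi)) :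
    branchLog (circleMap 0 s t) = Real.log s + t * Complex.I := by
  have hlog : -circleMap 0 s t = Complex.exp (Real.log s + (t - Real.pi) * Complex.I) := by
    rw [circleMap_zero, Complex.exp_add, ← Complex.ofReal_exp, Real.exp_log hs, sub_mul,
      Complex.exp_sub, Complex.exp_pi_mul_I]
    ring
  rw [branchLog, hlog, Complex.log_exp (by simpa using ht.1) (by simp; linarith [ht.2])]
  ring

lemma coef_exp_mul_branchLog {s : ℝ} (hs : 0 < s) (α κ : ℝ) (f : ℂ → ℂ) (n : ℤ) :
    coef (α + κ) (fun t => Complex.exp (κ * branchLog (circleMap 0 s t)) * f (circleMap 0 s t)) n =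
      ((s ^ κ : ℝ) : ℂ) * coef α (fun t => f (circleMap 0 s t)) n := by
  rw [← coef_add_exp_mul α κ, ← coef_const_mul]
  refine coef_congr_ae ?_ n
  filter_upwards [ae_restrict_mem measurableSet_Ioc] with t ht
  rw [branchLog_circleMap hs ht, mul_add, Complex.exp_add, mul_comm (κ : ℂ) (Real.log s),
    ← Complex.ofReal_mul, ← Complex.ofReal_exp, ← Real.rpow_def_of_pos hs, mul_assoc, mul_assoc]

lemma exp_branchLog {z : ℂ} (hz : z ≠ 0) : Complex.exp (branchLog z) = z := by
  rw [branchLog, Complex.exp_add, Complex.exp_log (neg_ne_zero.mpr hz), Complex.exp_pi_mul_I]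
  ring

lemma memLp_exp_mul_branchLog (hq0 : 0 < q) (κ : ℝ) :
    MemLp (fun z => Complex.exp (κ * branchLog z)) ∞ (boundaryMeasure q) := by
  refine memLp_top_of_bound (measurable_branchLog.const_mul _).cexp.aestronglyMeasurable
    (1 + q ^ κ) ?_
  filter_upwards [ae_mem_boundary hq0] with z hz
  rcases mem_boundary_iff.mp hz with h | h
  · simp [Complex.norm_exp, re_branchLog, h, Real.rpow_nonneg hq0.le]
  · simp [Complex.norm_exp, re_branchLog, h, Real.rpow_def_of_pos hq0, mul_comm κ]

lemma MemHardy.exp_mul_branchLog (hq0 : 0 < q) (hf : MemHardy q α f) (κ : ℝ) :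
    MemHardy q (α + κ) (fun z => Complex.exp (κ * branchLog z) * f z) where
  memLp := hf.memLp.mul (memLp_exp_mul_branchLog hq0 κ)
  coef_circle n := by
    rw [coef_exp_mul_branchLog hq0, coef_exp_mul_branchLog one_pos, hf.coef_circle, ← mul_assoc,
      ← Complex.ofReal_mul, ← Real.rpow_add hq0, Real.one_rpow, Complex.ofReal_one, one_mul]
    ring_nf

/-- `f` is a bounded function multiplication by which preserves every space `H²_α`; such functions
take the place of the space `H^∞` of the annulus. -/
structure IsMultiplier (q : ℝ) (f : ℂ → ℂ) : Prop where
  memLp : MemLp f ∞ (boundaryMeasure q)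
  mul_memHardy : ∀ {α : ℝ} {g : ℂ → ℂ}, MemHardy q α g → MemHardy q α (fun z => f z * g z)

namespace IsMultiplier

lemma memHardy (hf : IsMultiplier q f) : MemHardy q 0 f := by
  simpa only [mul_one] using hf.mul_memHardy MemHardy.one

lemma const (c : ℂ) : IsMultiplier q (fun _ => c) where
  memLp := memLp_const c
  mul_memHardy hg := hg.const_mul c

lemma add (hf : IsMultiplier q f) (hg : IsMultiplier q g) :
    IsMultiplier q (fun z => f z + g z) where
  memLp := hf.memLp.add hg.memLp
  mul_memHardy hu := by
    simpa only [add_mul] using (hf.mul_memHardy hu).add (hg.mul_memHardy hu)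

lemma mul (hf : IsMultiplier q f) (hg : IsMultiplier q g) :
    IsMultiplier q (fun z => f z * g z) where
  memLp := hg.memLp.mul hf.memLp
  mul_memHardy hu := by
    simpa only [mul_assoc] using hf.mul_memHardy (hg.mul_memHardy hu)

lemma const_mul (hf : IsMultiplier q f) (c : ℂ) : IsMultiplier q (fun z => c * f z) :=
  (const c).mul hf

lemma congr_ae (hf : IsMultiplier q f) (h : f =ᵐ[boundaryMeasure q] g) : IsMultiplier q g where
  memLp := hf.memLp.ae_eq h
  mul_memHardy {_ u} hu := (hf.mul_memHardy hu).congr_ae (h.mono fun z hz => by simp only [hz])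

lemma zpow (hq0 : 0 < q) (n : ℤ) : IsMultiplier q (fun z => z ^ n) := by
  have hexp : (fun z => Complex.exp ((n : ℝ) * branchLog z)) =ᵐ[boundaryMeasure q]
      fun z => z ^ n := by
    filter_upwards [ae_mem_boundary hq0] with z hz
    rw [Complex.ofReal_intCast, Complex.exp_int_mul, exp_branchLog (ne_zero_of_mem_boundary hq0 hz)]
  refine IsMultiplier.congr_ae ⟨memLp_exp_mul_branchLog hq0 n, fun hg => ?_⟩ hexp
  exact (MemHardy.add_intCast_iff n).mp (hg.exp_mul_branchLog hq0 n)

lemma of_tendsto {f : ℕ → ℂ → ℂ} {K : ℝ} (hf : ∀ i, IsMultiplier q (f i))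
    (hK : ∀ i, ∀ᵐ z ∂boundaryMeasure q, ‖f i z‖ ≤ K)
    (h : ∀ᵐ z ∂boundaryMeasure q, Tendsto (fun i => f i z) atTop (𝓝 (g z))) :
    IsMultiplier q g := by
  have hbound : ∀ᵐ z ∂boundaryMeasure q, ‖g z‖ ≤ K := by
    filter_upwards [ae_all_iff.mpr hK, h] with z hz hlim
    exact le_of_tendsto' hlim.norm hz
  have hg : MemLp g ∞ (boundaryMeasure q) :=
    memLp_top_of_bound (aestronglyMeasurable_of_tendsto_ae atTop (fun i => (hf i).memLp.1) h) K
      hbound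
  refine ⟨hg, fun {α u} hu => ?_⟩
  refine MemHardy.of_tendsto (fun i => (hf i).mul_memHardy hu) (hu.memLp.mul hg)
    (tendsto_eLpNorm_of_dominated two_ne_zero ENNReal.ofNat_ne_top (b := fun z => K * ‖u z‖)
      (fun i => ((hf i).mul_memHardy hu).memLp.1) (hu.memLp.norm.const_mul K) (fun i => ?_) ?_)
  · filter_upwards [hK i] with z hz
    rw [norm_mul]
    gcongr
  · filter_upwards [h] with z hz
    exact hz.mul_const (u z)

lemma exp (hf : IsMultiplier q f) : IsMultiplier q (fun z => Complex.exp (f z)) := by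
  obtain ⟨K, hK⟩ : ∃ K, ∀ᵐ z ∂boundaryMeasure q, ‖f z‖ ≤ K :=
    ⟨_, ae_le_lpNorm_exponent_top hf.memLp⟩
  have hpow (k : ℕ) : IsMultiplier q (fun z => f z ^ k / k.factorial) := by
    induction k with
    | zero => simpa using const 1
    | succ k ih =>
      refine ((hf.mul ih).const_mul ((k + 1 : ℕ) : ℂ)⁻¹).congr_ae (.of_forall fun z => ?_)
      simp only [Nat.factorial_succ, Nat.cast_mul, pow_succ]
      field_simp
  have hsum (n : ℕ) :
      IsMultiplier q (fun z => ∑ k ∈ Finset.range n, f z ^ k / k.factorial) := by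
    induction n with
    | zero => simpa using const 0
    | succ n ih => simpa only [Finset.sum_range_succ] using ih.add (hpow n)
  refine of_tendsto (K := Real.exp K) hsum (fun n => ?_) (.of_forall fun z => ?_)
  · filter_upwards [hK] with z hz
    calc ‖∑ k ∈ Finset.range n, f z ^ k / k.factorial‖
        ≤ ∑ k ∈ Finset.range n, ‖f z‖ ^ k / k.factorial := by
          refine (norm_sum_le _ _).trans_eq (Finset.sum_congr rfl fun k _ => ?_)
          simp
      _ ≤ Real.exp ‖f z‖ := Real.sum_le_exp_of_nonneg (norm_nonneg _) n
      _ ≤ Real.exp K := Real.exp_le_exp.mpr hz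
  · rw [Complex.exp_eq_exp_ℂ]
    exact (NormedSpace.expSeries_div_hasSum_exp (f z)).tendsto_sum_nat

end IsMultiplier

/-! ### Control by the real part -/

lemma lpNorm_two_sq {X E : Type*} [MeasurableSpace X] [NormedAddCommGroup E] {μ : Measure X}
    {f : X → E} (hf : AEStronglyMeasurable f μ) : lpNorm f 2 μ ^ 2 = ∫ x, ‖f x‖ ^ 2 ∂μ := by
  rw [lpNorm_eq_integral_norm_rpow_toReal two_ne_zero ENNReal.ofNat_ne_top hf]
  simp only [ENNReal.toReal_ofNat, Real.rpow_ofNat]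
  exact Real.rpow_inv_natCast_pow (integral_nonneg fun _ => by positivity) two_ne_zero

lemma hasSum_coef_circle (α : ℝ) (hf : MemLp f 2 (boundaryMeasure q)) :
    HasSum (fun n => ‖coef α (fun t => f (circleMap 0 1 t)) n‖ ^ 2 +
        ‖coef α (fun t => f (circleMap 0 q t)) n‖ ^ 2)
      ((2 * Real.pi)⁻¹ * lpNorm f 2 (boundaryMeasure q) ^ 2) := by
  have h1 := circleMeasure_one_le q
  have hq := circleMeasure_le q
  have hint {s : ℝ} (hs : circleMeasure s ≤ boundaryMeasure q) :
      ∫ z, ‖f z‖ ^ 2 ∂circleMeasure s = ∫ t, ‖f (circleMap 0 s t)‖ ^ 2 ∂angleMeasure :=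
    integral_map (continuous_circleMap 0 s).aemeasurable ((hf.1.mono_measure hs).norm.pow 2)
  have hsq : Integrable (fun z => ‖f z‖ ^ 2) (boundaryMeasure q) :=
    hf.integrable_norm_pow two_ne_zero
  rw [lpNorm_two_sq hf.1, boundaryMeasure,
    integral_add_measure (hsq.mono_measure h1) (hsq.mono_measure hq), hint h1, hint hq, mul_add]
  exact (hasSum_coef α (memLp_comp_circleMap h1 hf)).add
    (hasSum_coef α (memLp_comp_circleMap hq hf))

lemma mul_norm_le_norm_add_add_norm_add {r : ℝ} (hq1 : q < 1) (hr0 : 0 < r) (hr : r ≤ q)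
    (x y : ℂ) : (1 - q) * ‖x‖ ≤ ‖x + y‖ + ‖r * x + (r : ℂ)⁻¹ * y‖ := by
  have hr' : (r : ℂ) ≠ 0 := by exact_mod_cast hr0.ne'
  have hid : ((1 - r ^ 2 : ℝ) : ℂ) * x = (x + y) - r * (r * x + (r : ℂ)⁻¹ * y) := by
    field_simp
    push_cast
    ring
  calc (1 - q) * ‖x‖ ≤ (1 - r ^ 2) * ‖x‖ := by gcongr; nlinarith
    _ = ‖((1 - r ^ 2 : ℝ) : ℂ) * x‖ := by
      rw [norm_mul, Complex.norm_of_nonneg (by nlinarith)]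
    _ ≤ ‖x + y‖ + ‖r * (r * x + (r : ℂ)⁻¹ * y)‖ := hid ▸ norm_sub_le _ _
    _ ≤ ‖x + y‖ + ‖r * x + (r : ℂ)⁻¹ * y‖ := by
      rw [norm_mul, Complex.norm_of_nonneg hr0.le]
      gcongr
      exact mul_le_of_le_one_left (norm_nonneg _) (hr.trans hq1.le)

lemma norm_sq_add_norm_sq_le {r : ℝ} (hq1 : q < 1) (hr0 : 0 < r) (hr : r ≤ q ∨ r⁻¹ ≤ q)
    (x y : ℂ) :
    ‖x‖ ^ 2 + ‖r * x‖ ^ 2 ≤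
      (2 / (1 - q)) ^ 2 * (‖x + y‖ ^ 2 + ‖r * x + (r : ℂ)⁻¹ * y‖ ^ 2) := by
  wlog hrq : r ≤ q generalizing r x y
  · have hr' : (r : ℂ) ≠ 0 := by exact_mod_cast hr0.ne'
    have h := this (inv_pos.mpr hr0) (hr.symm.imp_right (by simp)) (r * x) ((r : ℂ)⁻¹ * y)
      (hr.resolve_left hrq)
    simpa [hr', add_comm] using h
  have hq : 0 < 1 - q := by linarith
  have hx : ‖x‖ ≤ (‖x + y‖ + ‖r * x + (r : ℂ)⁻¹ * y‖) / (1 - q) := by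
    rw [le_div_iff₀' hq]
    exact mul_norm_le_norm_add_add_norm_add hq1 hr0 hrq x y
  have hrx : ‖r * x‖ ≤ ‖x‖ := by
    rw [norm_mul, Complex.norm_of_nonneg hr0.le]
    exact mul_le_of_le_one_left (norm_nonneg _) (hrq.trans hq1.le)
  calc ‖x‖ ^ 2 + ‖r * x‖ ^ 2 ≤ 2 * ‖x‖ ^ 2 := by
        linarith [pow_le_pow_left₀ (norm_nonneg _) hrx 2]
    _ ≤ 2 * ((‖x + y‖ + ‖r * x + (r : ℂ)⁻¹ * y‖) / (1 - q)) ^ 2 := by gcongr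
    _ = 2 / (1 - q) ^ 2 * (‖x + y‖ + ‖r * x + (r : ℂ)⁻¹ * y‖) ^ 2 := by
      rw [div_pow]
      ring
    _ ≤ 2 / (1 - q) ^ 2 * (2 * (‖x + y‖ ^ 2 + ‖r * x + (r : ℂ)⁻¹ * y‖ ^ 2)) := by
      gcongr
      exact add_sq_le
    _ = (2 / (1 - q)) ^ 2 * (‖x + y‖ ^ 2 + ‖r * x + (r : ℂ)⁻¹ * y‖ ^ 2) := by
      rw [div_pow]
      ring

lemma zpow_le_or_inv_zpow_le (hq0 : 0 < q) (hq1 : q < 1) {n : ℤ} (hn : n ≠ 0) :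
    q ^ n ≤ q ∨ (q ^ n)⁻¹ ≤ q := by
  rcases hn.lt_or_gt with h | h
  · right
    rw [← zpow_neg]
    simpa using zpow_le_zpow_right_of_le_one₀ hq0 hq1.le (by lia : 1 ≤ -n)
  · left
    simpa using zpow_le_zpow_right_of_le_one₀ hq0 hq1.le (by lia : 1 ≤ n)

lemma coef_add_conj {s : ℝ} (hs : circleMeasure s ≤ boundaryMeasure q)
    (hf : MemLp f 2 (boundaryMeasure q)) (n : ℤ) :
    coef 0 (fun t => f (circleMap 0 s t) + (starRingEnd ℂ) (f (circleMap 0 s t))) n =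
      coef 0 (fun t => f (circleMap 0 s t)) n +
        (starRingEnd ℂ) (coef 0 (fun t => f (circleMap 0 s t)) (-n)) := by
  have h := memLp_comp_circleMap hs hf
  rw [coef_add (g := fun t => (starRingEnd ℂ) (f (circleMap 0 s t))) h h.star, coef_conj]

/-- With `c n` and `q ^ n * c n` the Fourier coefficients of `f` on the two circles, the right-hand
side contains those of `f + conj f`. These are two linear combinations of `c n` and
`conj (c (-n))`, and are proportional only for `n = 0`. -/
lemma norm_sq_add_norm_zpow_mul_sq_le (hq0 : 0 < q) (hq1 : q < 1) {c : ℤ → ℂ}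
    (hc : (c 0).im = 0) (n : ℤ) :
    ‖c n‖ ^ 2 + ‖((q ^ n : ℝ) : ℂ) * c n‖ ^ 2 ≤ (2 / (1 - q)) ^ 2 *
      (‖c n + (starRingEnd ℂ) (c (-n))‖ ^ 2 +
        ‖((q ^ n : ℝ) : ℂ) * c n + (starRingEnd ℂ) (((q ^ (-n) : ℝ) : ℂ) * c (-n))‖ ^ 2) := by
  rcases eq_or_ne n 0 with rfl | hn
  · have hreal : (starRingEnd ℂ) (c 0) = c 0 := Complex.conj_eq_iff_im.mpr hc
    have hq2 : 1 ≤ (2 / (1 - q)) ^ 2 := one_le_pow₀ ((one_le_div (by linarith)).mpr (by linarith))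
    simp only [zpow_zero, neg_zero, Complex.ofReal_one, one_mul, hreal, ← two_mul, norm_mul,
      Complex.norm_ofNat]
    nlinarith [sq_nonneg ‖c 0‖]
  · have h := norm_sq_add_norm_sq_le hq1 (zpow_pos hq0 n) (zpow_le_or_inv_zpow_le hq0 hq1 hn) (c n)
      ((starRingEnd ℂ) (c (-n)))
    rwa [← Complex.ofReal_inv, ← zpow_neg, ← Complex.conj_ofReal (q ^ (-n)), ← map_mul] at h

lemma lpNorm_add_conj_sq {X : Type*} [MeasurableSpace X] {μ : Measure X} {f : X → ℂ}
    (hf : MemLp f 2 μ) : lpNorm (fun x => f x + (starRingEnd ℂ) (f x)) 2 μ ^ 2 =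
      4 * lpNorm (fun x => (f x).re) 2 μ ^ 2 := by
  rw [lpNorm_two_sq (f := fun x => f x + (starRingEnd ℂ) (f x)) (hf.add hf.star).1,
    lpNorm_two_sq (f := fun x => (f x).re) hf.re.1, ← integral_const_mul]
  refine integral_congr_ae (.of_forall fun z => ?_)
  simp only [Complex.add_conj, Complex.norm_real, norm_mul, Real.norm_ofNat, mul_pow]
  norm_num

lemma MemHardy.lpNorm_le_lpNorm_re (hq0 : 0 < q) (hq1 : q < 1) (hf : MemHardy q 0 f)
    (him : (∫ z, f z ∂circleMeasure 1).im = 0) :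
    lpNorm f 2 (boundaryMeasure q) ≤
      4 / (1 - q) * lpNorm (fun z => (f z).re) 2 (boundaryMeasure q) := by
  set c : ℤ → ℂ := coef 0 (fun t => f (circleMap 0 1 t)) with hc
  have hzero : (c 0).im = 0 := by
    rw [integral_circleMeasure (hf.memLp.1.mono_measure (circleMeasure_one_le q))] at him
    simp [hc, coef_eq, him]
  have hcq (n : ℤ) : coef 0 (fun t => f (circleMap 0 q t)) n = ((q ^ n : ℝ) : ℂ) * c n := by
    rw [hf.coef_circle, add_zero, Real.rpow_intCast]
  have hsum := hasSum_coef_circle 0 hf.memLp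
  have hsum' := hasSum_coef_circle 0 (f := fun z => f z + (starRingEnd ℂ) (f z))
    (hf.memLp.add hf.memLp.star)
  simp only [hcq] at hsum
  simp only [coef_add_conj (circleMeasure_one_le q) hf.memLp,
    coef_add_conj (circleMeasure_le q) hf.memLp, hcq, lpNorm_add_conj_sq hf.memLp] at hsum'
  have hle := hasSum_le (norm_sq_add_norm_zpow_mul_sq_le hq0 hq1 hzero) hsum (hsum'.mul_left _)
  have : 0 < 1 - q := by linarith
  refine le_of_sq_le_sq ?_ (mul_nonneg (by positivity) lpNorm_nonneg)
  refine le_of_mul_le_mul_left (hle.trans_eq ?_) (by positivity : 0 < (2 * Real.pi)⁻¹)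
  rw [mul_pow, div_pow, div_pow]
  ring

/-! ### Approximation by real parts of multipliers -/

lemma pow_mul_conj_pow {z : ℂ} (hz : z ≠ 0) (j k : ℕ) :
    z ^ j * (starRingEnd ℂ) z ^ k = ((‖z‖ ^ (2 * k) : ℝ) : ℂ) * z ^ ((j : ℤ) - k) := by
  have h : ((‖z‖ ^ (2 * k) : ℝ) : ℂ) = z ^ k * (starRingEnd ℂ) z ^ k := by
    rw [← mul_pow, Complex.mul_conj']
    push_cast
    ring
  rw [h, zpow_sub₀ hz, zpow_natCast, zpow_natCast]
  field_simp

lemma re_conj_mul_zpow_neg (c z : ℂ) (n : ℤ) :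
    ((starRingEnd ℂ) c * z ^ (-n)).re = ‖z‖ ^ (-2 * n) * (c * z ^ n).re := by
  have h : (starRingEnd ℂ) (z ^ n)⁻¹ = ((‖z‖ ^ (-2 * n) : ℝ) : ℂ) * z ^ n := by
    rw [Complex.inv_def, map_mul, Complex.conj_conj, Complex.conj_ofReal, mul_comm,
      Complex.normSq_eq_norm_sq, norm_zpow, neg_mul, zpow_neg, mul_comm 2 n, zpow_mul]
    norm_cast
  rw [zpow_neg, ← Complex.conj_re, map_mul, Complex.conj_conj, h, mul_left_comm,
    Complex.re_ofReal_mul]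

lemma exists_isMultiplier_re_add_log (hq0 : 0 < q) (hq1 : q < 1) (c : ℂ) (j k : ℕ) :
    ∃ (h : ℂ → ℂ) (κ : ℝ), IsMultiplier q h ∧ ∀ z ∈ boundary q,
      (c * (z ^ j * (starRingEnd ℂ) z ^ k)).re = (h z).re + κ * Real.log ‖z‖ := by
  have hlog : Real.log q ≠ 0 := (Real.log_neg hq0 hq1).ne
  rcases eq_or_ne j k with rfl | hjk
  · refine ⟨fun _ => c, (q ^ (2 * j) - 1) * c.re / Real.log q, .const c, fun z hz => ?_⟩
    have hz0 := ne_zero_of_mem_boundary hq0 hz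
    rw [pow_mul_conj_pow hz0, sub_self, zpow_zero, mul_one, mul_comm, Complex.re_ofReal_mul]
    rcases mem_boundary_iff.mp hz with h | h
    · simp [h]
    · rw [h]
      field_simp
      ring
  · set n : ℤ := (j : ℤ) - k with hn
    have hq : q ^ (-2 * n) ≠ 1 := fun h => by
      rw [zpow_eq_one_iff_right₀ hq0.le hq1.ne] at h
      lia
    -- `ρ` makes `‖z‖ ^ (2 * k) = (1 - ρ) + ρ * ‖z‖ ^ (-2 * n)` hold on both circles, and
    -- `‖z‖ ^ (-2 * n) * z ^ n = conj (z ^ (-n))` has the real part of a Laurent monomial.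
    set ρ : ℝ := (q ^ (2 * k) - 1) / (q ^ (-2 * n) - 1) with hρ
    refine ⟨fun z => ((1 - ρ : ℝ) : ℂ) * c * z ^ n + (starRingEnd ℂ) (ρ * c) * z ^ (-n), 0,
      ((IsMultiplier.zpow hq0 n).const_mul _).add ((IsMultiplier.zpow hq0 (-n)).const_mul _),
      fun z hz => ?_⟩
    have hz0 := ne_zero_of_mem_boundary hq0 hz
    have hρz : ‖z‖ ^ (2 * k) = (1 - ρ) + ρ * ‖z‖ ^ (-2 * n) := by
      rcases mem_boundary_iff.mp hz with h | h
      · simp [h]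
      · rw [h, hρ]
        field_simp [sub_ne_zero.mpr hq]
        ring
    rw [pow_mul_conj_pow hz0, ← hn, mul_left_comm, Complex.re_ofReal_mul, hρz, Complex.add_re,
      re_conj_mul_zpow_neg, mul_assoc, mul_assoc, Complex.re_ofReal_mul, Complex.re_ofReal_mul]
    ring

lemma exists_isMultiplier_re_add_log_of_mem_adjoin (hq0 : 0 < q) (hq1 : q < 1)
    {F : C(boundary q, ℂ)}
    (hF : F ∈ StarAlgebra.adjoin ℂ {ContinuousMap.restrict (boundary q) (.id ℂ)}) (c : ℂ) :
    ∃ (h : ℂ → ℂ) (κ : ℝ), IsMultiplier q h ∧ ∀ z : boundary q,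
      (c * F z).re = (h z).re + κ * Real.log ‖(z : ℂ)‖ := by
  rw [← StarSubalgebra.mem_toSubalgebra, ← Subalgebra.mem_toSubmodule,
    StarAlgebra.adjoin_eq_span, Set.star_singleton, Set.singleton_union] at hF
  induction hF using Submodule.span_induction generalizing c with
  | mem F hF =>
    obtain ⟨j, k, rfl⟩ := (Submonoid.mem_closure_pair _ _ _).mp hF
    obtain ⟨h, κ, hh, heq⟩ := exists_isMultiplier_re_add_log hq0 hq1 c j k
    exact ⟨h, κ, hh, fun z => heq z z.2⟩
  | zero => exact ⟨fun _ => 0, 0, .const 0, fun z => by simp⟩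
  | add F G _ _ ihF ihG =>
    obtain ⟨h₁, κ₁, hh₁, heq₁⟩ := ihF c
    obtain ⟨h₂, κ₂, hh₂, heq₂⟩ := ihG c
    refine ⟨_, κ₁ + κ₂, hh₁.add hh₂, fun z => ?_⟩
    rw [ContinuousMap.add_apply, mul_add, Complex.add_re, heq₁, heq₂, Complex.add_re]
    ring
  | smul a F _ ih =>
    obtain ⟨h, κ, hh, heq⟩ := ih (c * a)
    exact ⟨h, κ, hh, fun z => by rw [← heq, ContinuousMap.smul_apply, smul_eq_mul, mul_assoc]⟩

lemma exists_isMultiplier_abs_re_add_log_sub_lt (hq0 : 0 < q) (hq1 : q < 1) {w : ℂ → ℝ}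
    (hw : Continuous w) {ε : ℝ} (hε : 0 < ε) :
    ∃ (h : ℂ → ℂ) (κ : ℝ), IsMultiplier q h ∧ ∀ z ∈ boundary q,
      |(h z).re + κ * Real.log ‖z‖ - w z| < ε := by
  let W : C(boundary q, ℂ) := ⟨fun z => w z, by fun_prop⟩
  have hW : W ∈ StarAlgebra.elemental ℂ (ContinuousMap.restrict (boundary q) (.id ℂ)) := by
    simp [ContinuousMap.elemental_id_eq_top]
  rw [StarAlgebra.elemental, ← SetLike.mem_coe, StarSubalgebra.topologicalClosure_coe] at hW
  obtain ⟨F, hF, hdist⟩ := Metric.mem_closure_iff.mp hW ε hε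
  obtain ⟨h, κ, hh, heq⟩ := exists_isMultiplier_re_add_log_of_mem_adjoin hq0 hq1 hF 1
  refine ⟨h, κ, hh, fun z hz => ?_⟩
  calc |(h z).re + κ * Real.log ‖z‖ - w z| = |(F ⟨z, hz⟩ - W ⟨z, hz⟩).re| := by
        rw [← heq ⟨z, hz⟩, one_mul, Complex.sub_re]
        rfl
    _ ≤ dist (F ⟨z, hz⟩) (W ⟨z, hz⟩) := by
      rw [dist_eq_norm]
      exact Complex.abs_re_le_norm _
    _ ≤ dist F W := ContinuousMap.dist_apply_le_dist _
    _ < ε := by rwa [dist_comm]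

lemma exists_seq_continuous_tendsto_ae {X : Type*} [TopologicalSpace X] [NormalSpace X]
    [MeasurableSpace X] [BorelSpace X] {μ : Measure X} [μ.WeaklyRegular] [IsFiniteMeasure μ]
    {v : X → ℝ} (hv : MemLp v ∞ μ) :
    ∃ (w : ℕ → X → ℝ) (K : ℝ), (∀ n, Continuous (w n)) ∧ (∀ n x, |w n x| ≤ K) ∧
      ∀ᵐ x ∂μ, Tendsto (fun n => w n x) atTop (𝓝 (v x)) := by
  choose g hg hgL using fun n : ℕ =>
    (hv.mono_exponent (p := 1) le_top).exists_boundedContinuous_eLpNorm_sub_le ENNReal.one_ne_top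
      (ENNReal.inv_ne_zero.mpr (ENNReal.natCast_ne_top n))
  have hlim : Tendsto (fun n => eLpNorm (⇑(g n) - v) 1 μ) atTop (𝓝 0) := by
    refine tendsto_of_tendsto_of_tendsto_of_le_of_le tendsto_const_nhds
      ENNReal.tendsto_inv_nat_nhds_zero (fun _ => zero_le) fun n => ?_
    rw [eLpNorm_sub_comm]
    exact hg n
  obtain ⟨ns, -, hns⟩ := (tendstoInMeasure_of_tendsto_eLpNorm one_ne_zero
    (fun n => (hgL n).1) hv.1 hlim).exists_seq_tendsto_ae
  set K := lpNorm v ∞ μ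
  refine ⟨fun n x => max (-K) (min (g (ns n) x) K), K, fun n => by fun_prop, fun n x => ?_, ?_⟩
  · have hK0 : 0 ≤ K := lpNorm_nonneg
    exact abs_le.mpr ⟨le_max_left _ _, max_le (by linarith) (min_le_right _ _)⟩
  · filter_upwards [hns, ae_le_lpNorm_exponent_top hv] with x hx hxK
    have hclamp : max (-K) (min (v x) K) = v x := by
      rw [min_eq_left (abs_le.mp hxK).2, max_eq_right (abs_le.mp hxK).1]
    have h := (tendsto_const_nhds (x := -K)).max (hx.min (tendsto_const_nhds (x := K)))
    rwa [hclamp] at h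

lemma re_integral_circleMeasure {s : ℝ} (hs : circleMeasure s ≤ boundaryMeasure q)
    (hf : MemLp f 2 (boundaryMeasure q)) :
    ∫ z, (f z).re ∂circleMeasure s = (∫ z, f z ∂circleMeasure s).re :=
  integral_re ((hf.mono_measure hs).integrable one_le_two)

lemma circleMeasure_real_univ (s : ℝ) : (circleMeasure s).real univ = 2 * Real.pi := by
  rw [circleMeasure, map_measureReal_apply (continuous_circleMap 0 s).measurable .univ]
  simp [angleMeasure, Real.pi_nonneg]

lemma integral_log_norm_circleMeasure {s : ℝ} (hs : 0 ≤ s) :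
    ∫ z, Real.log ‖z‖ ∂circleMeasure s = 2 * Real.pi * Real.log s := by
  have h : (fun z : ℂ => Real.log ‖z‖) =ᵐ[circleMeasure s] fun _ => Real.log s :=
    (ae_norm_eq_circleMeasure hs).mono fun z hz => by simp only [hz]
  rw [integral_congr_ae h, integral_const, smul_eq_mul, circleMeasure_real_univ]

lemma memLp_log_norm (hq0 : 0 < q) (p : ℝ≥0∞) :
    MemLp (fun z : ℂ => Real.log ‖z‖) p (boundaryMeasure q) := by
  refine MemLp.of_bound measurable_norm.log.aestronglyMeasurable |Real.log q| ?_
  filter_upwards [ae_mem_boundary hq0] with z hz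
  rcases mem_boundary_iff.mp hz with h | h <;> simp [h]

lemma integral_re_add_log_sub (hq0 : 0 < q) (hf : MemHardy q 0 f) (κ : ℝ) :
    ∫ z, ((f z).re + κ * Real.log ‖z‖) ∂circleMeasure q -
      ∫ z, ((f z).re + κ * Real.log ‖z‖) ∂circleMeasure 1 = κ * (2 * Real.pi * Real.log q) := by
  have h {s : ℝ} (hs0 : 0 ≤ s) (hs : circleMeasure s ≤ boundaryMeasure q) :
      ∫ z, ((f z).re + κ * Real.log ‖z‖) ∂circleMeasure s =
        (∫ z, f z ∂circleMeasure s).re + κ * (2 * Real.pi * Real.log s) := by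
    have hre : Integrable (fun z => (f z).re) (circleMeasure s) :=
      (hf.memLp.mono_measure hs).re.integrable one_le_two
    rw [integral_add hre
      ((((memLp_log_norm hq0 1).mono_measure hs).integrable le_rfl).const_mul κ),
      re_integral_circleMeasure hs hf.memLp, integral_const_mul,
      integral_log_norm_circleMeasure hs0]
  rw [h hq0.le (circleMeasure_le q), h zero_le_one (circleMeasure_one_le q), hf.integral_eq,
    Real.log_one]
  ring

lemma exists_seq_isMultiplier_re_add_log_tendsto (hq0 : 0 < q) (hq1 : q < 1) {v : ℂ → ℝ}
    (hv : MemLp v ∞ (boundaryMeasure q)) :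
    ∃ (h : ℕ → ℂ → ℂ) (κ : ℕ → ℝ) (K : ℝ), (∀ n, IsMultiplier q (h n)) ∧
      (∀ n, ∀ᵐ z ∂boundaryMeasure q, |(h n z).re + κ n * Real.log ‖z‖| ≤ K) ∧
      ∀ᵐ z ∂boundaryMeasure q,
        Tendsto (fun n => (h n z).re + κ n * Real.log ‖z‖) atTop (𝓝 (v z)) := by
  obtain ⟨w, K, hw, hwK, hwv⟩ := exists_seq_continuous_tendsto_ae hv
  choose h κ hh happrox using fun n : ℕ =>
    exists_isMultiplier_abs_re_add_log_sub_lt hq0 hq1 (hw n) (Nat.one_div_pos_of_nat (n := n))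
  refine ⟨h, κ, K + 1, hh, fun n => ?_, ?_⟩
  · filter_upwards [ae_mem_boundary hq0] with z hz
    have hn : 1 / ((n : ℝ) + 1) ≤ 1 := div_le_one_of_le₀ (by simp) (by positivity)
    linarith [abs_sub_abs_le_abs_sub ((h n z).re + κ n * Real.log ‖z‖) (w n z), hwK n z,
      happrox n z hz]
  · filter_upwards [ae_mem_boundary hq0, hwv] with z hz hzv
    have h0 : Tendsto (fun n => (h n z).re + κ n * Real.log ‖z‖ - w n z) atTop (𝓝 0) :=
      squeeze_zero_norm (fun n => (happrox n z hz).le) tendsto_one_div_add_atTop_nhds_zero_nat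
    simpa using h0.add hzv

lemma exists_seq_isMultiplier_re_tendsto (hq0 : 0 < q) (hq1 : q < 1) {v : ℂ → ℝ}
    (hv : MemLp v ∞ (boundaryMeasure q))
    (hmean : ∫ z, v z ∂circleMeasure q = ∫ z, v z ∂circleMeasure 1) :
    ∃ (h : ℕ → ℂ → ℂ) (K : ℝ), (∀ n, IsMultiplier q (h n)) ∧
      (∀ n, ∀ᵐ z ∂boundaryMeasure q, |(h n z).re| ≤ K) ∧
      ∀ᵐ z ∂boundaryMeasure q, Tendsto (fun n => (h n z).re) atTop (𝓝 (v z)) := by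
  obtain ⟨h, κ, K, hh, huK, huv⟩ := exists_seq_isMultiplier_re_add_log_tendsto hq0 hq1 hv
  have hint {s : ℝ} (hs : circleMeasure s ≤ boundaryMeasure q) :
      Tendsto (fun n => ∫ z, ((h n z).re + κ n * Real.log ‖z‖) ∂circleMeasure s) atTop
        (𝓝 (∫ z, v z ∂circleMeasure s)) :=
    tendsto_integral_of_dominated_convergence (fun _ => K)
      (fun n => ((hh n).memLp.re.add ((memLp_log_norm hq0 ∞).const_mul (κ n))).1.mono_measure hs)
      (integrable_const _) (fun n => ae_mono hs (huK n)) (ae_mono hs huv)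
  have hκ : Tendsto κ atTop (𝓝 0) := by
    have hlog : 2 * Real.pi * Real.log q ≠ 0 :=
      mul_ne_zero Real.two_pi_pos.ne' (Real.log_neg hq0 hq1).ne
    have h := ((hint (circleMeasure_le q)).sub (hint (circleMeasure_one_le q))).div_const
      (2 * Real.pi * Real.log q)
    simp only [integral_re_add_log_sub hq0 (hh _).memHardy, hmean, sub_self, zero_div] at h
    exact h.congr fun n => mul_div_cancel_right₀ _ hlog
  obtain ⟨C, hC⟩ := (Metric.isBounded_range_of_tendsto κ hκ).exists_norm_le
  have hκC (n : ℕ) : |κ n| ≤ C := hC _ (mem_range_self n)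
  refine ⟨h, K + C * |Real.log q|, hh, fun n => ?_, ?_⟩
  · filter_upwards [huK n, ae_mem_boundary hq0] with z hz hzb
    have hle : |Real.log ‖z‖| ≤ |Real.log q| := by
      rcases mem_boundary_iff.mp hzb with h | h <;> simp [h]
    calc |(h n z).re| = |(h n z).re + κ n * Real.log ‖z‖ - κ n * Real.log ‖z‖| := by simp
      _ ≤ |(h n z).re + κ n * Real.log ‖z‖| + |κ n * Real.log ‖z‖| := abs_sub _ _
      _ ≤ K + C * |Real.log q| := by
        rw [abs_mul (κ n)]
        exact add_le_add hz
          (mul_le_mul (hκC n) hle (abs_nonneg _) ((abs_nonneg _).trans (hκC n)))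
  · filter_upwards [huv] with z hz
    simpa using hz.sub (hκ.mul_const (Real.log ‖z‖))

/-! ### Outer functions -/

lemma IsMultiplier.exists_re_eq_im_integral_eq_zero (hf : IsMultiplier q f) :
    ∃ g, IsMultiplier q g ∧ (∀ z, (g z).re = (f z).re) ∧
      (∫ z, g z ∂circleMeasure 1).im = 0 := by
  set c : ℝ := (∫ z, f z ∂circleMeasure 1).im / (2 * Real.pi) with hc
  refine ⟨fun z => f z + (-(c * Complex.I)), hf.add (.const _), fun z => by simp, ?_⟩
  rw [integral_add ((hf.memHardy.memLp.mono_measure (circleMeasure_one_le q)).integrable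
    one_le_two) (integrable_const _), integral_const, circleMeasure_real_univ]
  simp only [hc, Complex.add_im, Complex.real_smul, Complex.im_ofReal_mul,
    Complex.neg_im, Complex.mul_I_im, Complex.ofReal_re]
  field_simp
  ring

lemma exists_subseq_ae_tendsto_of_re_tendsto (hq0 : 0 < q) (hq1 : q < 1) {f : ℕ → ℂ → ℂ}
    {v : ℂ → ℝ} (hf : ∀ n, MemHardy q 0 (f n))
    (him : ∀ n, (∫ z, f n z ∂circleMeasure 1).im = 0) (hv : MemLp v 2 (boundaryMeasure q))
    (h : Tendsto (fun n => eLpNorm ((fun z => (f n z).re) - v) 2 (boundaryMeasure q)) atTop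
      (𝓝 0)) :
    ∃ ns : ℕ → ℕ, StrictMono ns ∧
      ∀ᵐ z ∂boundaryMeasure q, ∃ l, Tendsto (fun k => f (ns k) z) atTop (𝓝 l) := by
  have hre (n : ℕ) : MemLp (fun z => (f n z).re) 2 (boundaryMeasure q) := (hf n).memLp.re
  obtain ⟨ns, hns, hfast⟩ := extraction_forall_of_eventually fun N : ℕ =>
    h.eventually (gt_mem_nhds (ENNReal.ofReal_pos.mpr (pow_pos (one_half_pos (α := ℝ)) N)))
  refine ⟨ns, hns, Lp.ae_tendsto_of_cauchy_eLpNorm (fun k => (hf (ns k)).memLp.1) one_le_two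
    (summable_geometric_two.mul_left (4 / (1 - q) * 2)).tsum_ofReal_ne_top fun N n m hn hm => ?_⟩
  have : 0 < 4 / (1 - q) := div_pos four_pos (sub_pos.mpr hq1)
  have hlp {k : ℕ} (hk : N ≤ k) :
      lpNorm ((fun z => (f (ns k) z).re) - v) 2 (boundaryMeasure q) < (1 / 2) ^ N := by
    have hk' := hfast k
    rw [← ofReal_lpNorm ((hre _).sub hv), ENNReal.ofReal_lt_ofReal_iff (by positivity)] at hk'
    exact hk'.trans_le (pow_le_pow_of_le_one one_half_pos.le one_half_lt_one.le hk)
  have hsub : MemHardy q 0 (fun z => f (ns n) z - f (ns m) z) := by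
    simpa only [neg_one_mul, ← sub_eq_add_neg] using (hf (ns n)).add ((hf (ns m)).const_mul (-1))
  have hsub_im : (∫ z, (f (ns n) z - f (ns m) z) ∂circleMeasure 1).im = 0 := by
    have hint (k : ℕ) : Integrable (f k) (circleMeasure 1) :=
      ((hf k).memLp.mono_measure (circleMeasure_one_le q)).integrable one_le_two
    rw [integral_sub (hint _) (hint _), Complex.sub_im, him, him, sub_zero]
  rw [← ofReal_lpNorm (f := f (ns n) - f (ns m)) hsub.memLp,
    ENNReal.ofReal_lt_ofReal_iff (by positivity)]
  calc lpNorm (f (ns n) - f (ns m)) 2 (boundaryMeasure q)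
      ≤ 4 / (1 - q) * lpNorm ((fun z => (f (ns n) z).re) - fun z => (f (ns m) z).re) 2
          (boundaryMeasure q) := hsub.lpNorm_le_lpNorm_re hq0 hq1 hsub_im
    _ ≤ 4 / (1 - q) * (lpNorm ((fun z => (f (ns n) z).re) - v) 2 (boundaryMeasure q) +
          lpNorm ((fun z => (f (ns m) z).re) - v) 2 (boundaryMeasure q)) := by
        gcongr
        rw [lpNorm_sub_comm (fun z => (f (ns m) z).re) v]
        exact lpNorm_sub_le_lpNorm_sub_add_lpNorm_sub (hre _) hv one_le_two
    _ < 4 / (1 - q) * ((1 / 2) ^ N + (1 / 2) ^ N) := by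
        gcongr
        exacts [hlp hn, hlp hm]
    _ = 4 / (1 - q) * 2 * (1 / 2) ^ N := by ring

lemma exists_re_eq_isMultiplier_exp (hq0 : 0 < q) (hq1 : q < 1) {v : ℂ → ℝ}
    (hv : MemLp v ∞ (boundaryMeasure q))
    (hmean : ∫ z, v z ∂circleMeasure q = ∫ z, v z ∂circleMeasure 1) :
    ∃ H : ℂ → ℂ, (∀ᵐ z ∂boundaryMeasure q, (H z).re = v z) ∧
      IsMultiplier q (fun z => Complex.exp (H z)) ∧
      IsMultiplier q (fun z => Complex.exp (-H z)) := by
  obtain ⟨h, K, hh, hK, hlim⟩ := exists_seq_isMultiplier_re_tendsto hq0 hq1 hv hmean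
  choose f hf hre him using fun n => (hh n).exists_re_eq_im_integral_eq_zero
  simp only [← hre] at hK hlim
  obtain ⟨ns, hns, hconv⟩ := exists_subseq_ae_tendsto_of_re_tendsto hq0 hq1
    (fun n => (hf n).memHardy) him (hv.mono_exponent le_top)
    (tendsto_eLpNorm_of_dominated two_ne_zero ENNReal.ofNat_ne_top
      (fun n => (hf n).memLp.re.1) (memLp_const K) hK hlim)
  set H : ℂ → ℂ := fun z => limUnder atTop fun k => f (ns k) z
  have hH : ∀ᵐ z ∂boundaryMeasure q, Tendsto (fun k => f (ns k) z) atTop (𝓝 (H z)) :=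
    hconv.mono fun z hz => tendsto_nhds_limUnder hz
  refine ⟨H, ?_, ?_, ?_⟩
  · filter_upwards [hH, hlim] with z hHz hz
    exact tendsto_nhds_unique ((Complex.continuous_re.tendsto _).comp hHz)
      (hz.comp hns.tendsto_atTop)
  · refine .of_tendsto (K := Real.exp K) (fun k => (hf (ns k)).exp) (fun k => ?_)
      (hH.mono fun z hz => hz.cexp)
    filter_upwards [hK (ns k)] with z hz
    rw [Complex.norm_exp]
    exact Real.exp_le_exp.mpr (abs_le.mp hz).2
  · refine .of_tendsto (K := Real.exp K) (fun k => ((hf (ns k)).const_mul (-1)).exp) (fun k => ?_)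
      (hH.mono fun z hz => ?_)
    · filter_upwards [hK (ns k)] with z hz
      simp only [neg_one_mul, Complex.norm_exp, Complex.neg_re, Real.exp_le_exp]
      linarith [(abs_le.mp hz).1]
    · simpa only [neg_one_mul] using hz.neg.cexp

lemma exists_outer_norm_eq_exp (hq0 : 0 < q) (hq1 : q < 1) {v : ℂ → ℝ} {κ : ℝ}
    (hv : MemLp v ∞ (boundaryMeasure q))
    (hperiod : ∫ z, v z ∂circleMeasure q - ∫ z, v z ∂circleMeasure 1 =
      κ * (2 * Real.pi * Real.log q)) :
    ∃ u : ℂ → ℂ, MemHardy q κ u ∧ (∀ᵐ z ∂boundaryMeasure q, ‖u z‖ = Real.exp (v z)) ∧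
      ∀ g, MemHardy q κ g → MemHardy q 0 (fun z => g z / u z) := by
  have hint {s : ℝ} (hs0 : 0 ≤ s) (hs : circleMeasure s ≤ boundaryMeasure q) :
      ∫ z, (v z - κ * Real.log ‖z‖) ∂circleMeasure s =
        ∫ z, v z ∂circleMeasure s - κ * (2 * Real.pi * Real.log s) := by
    rw [integral_sub ((hv.mono_measure hs).integrable le_top)
      ((((memLp_log_norm hq0 1).mono_measure hs).integrable le_rfl).const_mul κ),
      integral_const_mul, integral_log_norm_circleMeasure hs0]
  obtain ⟨H, hHre, hexp, hexp_neg⟩ := exists_re_eq_isMultiplier_exp hq0 hq1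
    (hv.sub ((memLp_log_norm hq0 ∞).const_mul κ)) (by
      simp only [Pi.sub_apply]
      rw [hint hq0.le (circleMeasure_le q), hint zero_le_one (circleMeasure_one_le q), Real.log_one]
      linarith)
  refine ⟨fun z => Complex.exp (κ * branchLog z) * Complex.exp (H z), ?_, ?_, fun g hg => ?_⟩
  · simpa using hexp.memHardy.exp_mul_branchLog hq0 κ
  · filter_upwards [hHre] with z hz
    simp [Complex.norm_exp, re_branchLog, hz, ← Real.exp_add]
  · have h := hexp_neg.mul_memHardy (hg.exp_mul_branchLog hq0 (-κ))
    rw [add_neg_cancel] at h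
    refine h.congr_ae (.of_forall fun z => ?_)
    simp only [Complex.ofReal_neg, neg_mul, Complex.exp_neg, div_eq_mul_inv, mul_inv]
    ring

/-! ### Eigenvalues of Toeplitz operators -/

lemma boundaryMeasure_ne_zero : boundaryMeasure q ≠ 0 := by
  have h : circleMeasure 1 ≠ 0 := fun h => Real.two_pi_pos.ne' <| by
    rw [← circleMeasure_real_univ 1, h, measureReal_zero_apply]
  exact fun h0 => h (le_bot_iff.mp ((circleMeasure_one_le q).trans_eq h0))

section Eigenvalue

variable {l m M σ : ℝ} {φ : ℂ → ℝ}

lemma hasEigenvalue_toeplitz_of_inner_eq_zero (hq0 : 0 < q) (hq1 : q < 1)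
    (hφ : MemLp φ ∞ (boundaryMeasure q)) {u : Lp ℂ 2 (boundaryMeasure q)}
    (hu : u ∈ hardySpace q α hq0 hq1) (hu0 : u ≠ 0)
    (horth : ∀ w ∈ hardySpace q α hq0 hq1,
      inner ℂ (multiplication q φ hφ u - (l : ℂ) • u) w = 0) :
    Module.End.HasEigenvalue (toeplitz q α hq0 hq1 φ hφ).toLinearMap (l : ℂ) := by
  refine Module.End.hasEigenvalue_of_hasEigenvector (x := ⟨u, hu⟩)
    ⟨Module.End.mem_eigenspace_iff.mpr (Subtype.ext ?_), fun h => hu0 (congrArg Subtype.val h)⟩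
  exact Submodule.eq_starProjection_of_mem_of_inner_eq_zero (Submodule.smul_mem _ _ hu) horth

lemma inner_mul_eq_mul_div {c : ℝ} {u w : ℂ} (hu : u ≠ 0) (h : c * ‖u‖ ^ 2 = σ) :
    inner ℂ (c * u) w = σ * (w / u) := by
  rw [RCLike.inner_apply, map_mul, Complex.conj_ofReal, ← h, mul_div_assoc', eq_div_iff hu]
  push_cast [← Complex.mul_conj']
  ring

lemma hasEigenvalue_toeplitz_of_mul_norm_sq_eq (hq0 : 0 < q) (hq1 : q < 1)
    (hφ : MemLp φ ∞ (boundaryMeasure q)) {u : ℂ → ℂ} (hu : MemHardy q α u)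
    (hu0 : ∀ᵐ z ∂boundaryMeasure q, u z ≠ 0)
    (hdiv : ∀ g, MemHardy q α g → MemHardy q 0 (fun z => g z / u z))
    (h1 : ∀ᵐ z ∂circleMeasure 1, (φ z - l) * ‖u z‖ ^ 2 = σ)
    (hq : ∀ᵐ z ∂circleMeasure q, (φ z - l) * ‖u z‖ ^ 2 = -σ) :
    Module.End.HasEigenvalue (toeplitz q α hq0 hq1 φ hφ).toLinearMap (l : ℂ) := by
  refine hasEigenvalue_toeplitz_of_inner_eq_zero hq0 hq1 hφ (hu.toLp_mem_hardySpace hq0 hq1)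
    (fun h => ?_) fun w hw => ?_
  · have := ae_neBot.mpr (boundaryMeasure_ne_zero (q := q))
    have hu_zero := hu.memLp.coeFn_toLp.symm.trans (Lp.eq_zero_iff_ae_eq_zero.mp h)
    obtain ⟨z, hz0, hz⟩ := (hu0.and hu_zero).exists
    exact hz0 hz
  set y := multiplication q φ hφ (hu.memLp.toLp u) - (l : ℂ) • hu.memLp.toLp u with hy
  have hyae : y =ᵐ[boundaryMeasure q] fun z => ((φ z - l : ℝ) : ℂ) * u z := by
    filter_upwards [Lp.coeFn_sub (multiplication q φ hφ (hu.memLp.toLp u))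
      ((l : ℂ) • hu.memLp.toLp u), multiplication_ae q φ hφ (hu.memLp.toLp u),
      Lp.coeFn_smul (l : ℂ) (hu.memLp.toLp u), hu.memLp.coeFn_toLp] with z hsub hmul hsmul hz
    rw [hy, hsub, Pi.sub_apply, hmul, hsmul, Pi.smul_apply, smul_eq_mul, hz]
    push_cast
    ring
  have hinner {s τ : ℝ} (hs : circleMeasure s ≤ boundaryMeasure q)
      (h : ∀ᵐ z ∂circleMeasure s, (φ z - l) * ‖u z‖ ^ 2 = τ) :
      ∫ z, inner ℂ (y z) (w z) ∂circleMeasure s = τ * ∫ z, w z / u z ∂circleMeasure s := by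
    rw [← integral_const_mul]
    refine integral_congr_ae ?_
    filter_upwards [ae_mono hs hyae, ae_mono hs hu0, h] with z hz hz0 hzτ
    rw [hz, inner_mul_eq_mul_div hz0 hzτ]
  have hint : Integrable (fun z => inner ℂ (y z) (w z)) (boundaryMeasure q) :=
    L2.integrable_inner y w
  have hsum : ∫ z, inner ℂ (y z) (w z) ∂boundaryMeasure q =
      ∫ z, inner ℂ (y z) (w z) ∂circleMeasure 1 + ∫ z, inner ℂ (y z) (w z) ∂circleMeasure q :=
    integral_add_measure (hint.mono_measure (circleMeasure_one_le q))
      (hint.mono_measure (circleMeasure_le q))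
  rw [L2.inner_def, hsum, hinner (circleMeasure_one_le q) h1, hinner (circleMeasure_le q) hq,
    (hdiv w ((MemHardy.coeFn_iff hq0 hq1).mpr hw)).integral_eq]
  push_cast
  ring

lemma hasEigenvalue_toeplitz_of_integral_log_sub_eq (hq0 : 0 < q) (hq1 : q < 1)
    (hφ : MemLp φ ∞ (boundaryMeasure q)) (hl : l ∈ Ioo m M)
    (hsep : ∀ᵐ z ∂boundaryMeasure q, φ z ∉ Ioo m M)
    (h1 : ∀ᵐ z ∂circleMeasure 1, φ z - l = σ * |φ z - l|)
    (hq : ∀ᵐ z ∂circleMeasure q, φ z - l = -σ * |φ z - l|)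
    {k : ℤ} (hperiod : ∫ z, Real.log |φ z - l| ∂circleMeasure 1 -
      ∫ z, Real.log |φ z - l| ∂circleMeasure q = 4 * Real.pi * Real.log q * (α + k)) :
    Module.End.HasEigenvalue (toeplitz q α hq0 hq1 φ hφ).toLinearMap (l : ℂ) := by
  have hlog := memLp_log_abs_sub_of_notMem_Ioo hφ hsep hl
  obtain ⟨u, hu, hunorm, hdiv⟩ := exists_outer_norm_eq_exp (κ := α + k) hq0 hq1
    (hlog.const_mul (-(1 / 2)))
    (by simp only [integral_const_mul]; linear_combination (1 / 2) * hperiod)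
  simp only [MemHardy.add_intCast_iff] at hu hdiv
  have hsq : ∀ᵐ z ∂boundaryMeasure q, |φ z - l| * ‖u z‖ ^ 2 = 1 := by
    filter_upwards [hunorm, hsep] with z hz hzsep
    have hpos : 0 < |φ z - l| := abs_pos.mpr (sub_ne_zero.mpr fun hzl => hzsep (hzl ▸ hl))
    have hexp : ((2 : ℕ) : ℝ) * (-(1 / 2) * Real.log |φ z - l|) = -Real.log |φ z - l| := by
      push_cast
      ring
    rw [hz, ← Real.exp_nat_mul, hexp, Real.exp_neg, Real.exp_log hpos, mul_inv_cancel₀ hpos.ne']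
  refine hasEigenvalue_toeplitz_of_mul_norm_sq_eq (σ := σ) hq0 hq1 hφ hu ?_ hdiv ?_ ?_
  · filter_upwards [hsq] with z hz h0
    simp [h0] at hz
  · filter_upwards [h1, ae_mono (circleMeasure_one_le q) hsq] with z hz hzsq
    rw [hz, mul_assoc, hzsq, mul_one]
  · filter_upwards [hq, ae_mono (circleMeasure_le q) hsq] with z hz hzsq
    rw [hz, mul_assoc, hzsq, mul_one]

end Eigenvalue

end AnnulusToeplitz

open AnnulusToeplitz

theorem corollary2p4_general (q : ℝ) (hq0 : 0 < q) (hq1 : q < 1) (φ : ℂ → ℝ)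
    (hφ : MemLp φ ∞ (boundaryMeasure q)) {m M : ℝ} (hmM : m < M)
    (hsep :
      ((∀ᵐ z ∂circleMeasure q, φ z ≤ m) ∧ ∀ᵐ z ∂circleMeasure 1, M ≤ φ z) ∨
      ((∀ᵐ z ∂circleMeasure 1, φ z ≤ m) ∧ ∀ᵐ z ∂circleMeasure q, M ≤ φ z))
    (hlog : LogIntegralEqBot q φ M ∨ LogIntegralEqBot q φ m) (α : ℝ) :
    {l : ℝ | l ∈ Ioo m M ∧
      Module.End.HasEigenvalue (toeplitz q α hq0 hq1 φ hφ).toLinearMap (l : ℂ)}.Infinite := by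
  have hr : 4 * Real.pi * Real.log q ≠ 0 :=
    mul_ne_zero (by positivity) (Real.log_neg hq0 hq1).ne
  have h1 := hφ.mono_measure (circleMeasure_one_le q)
  have hq := hφ.mono_measure (circleMeasure_le q)
  have hdiv := hlog.imp And.right And.right
  rcases hsep with ⟨hm, hM⟩ | ⟨hm, hM⟩
  · refine (infinite_setOf_integral_log_sub_eq hmM h1 hq hM hm hdiv hr α).mono ?_
    rintro l ⟨hl, k, hk⟩
    refine ⟨hl, hasEigenvalue_toeplitz_of_integral_log_sub_eq (σ := 1) hq0 hq1 hφ hl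
      (ae_add_measure_iff.mpr ⟨hM.mono fun z hz h => hz.not_gt h.2,
        hm.mono fun z hz h => hz.not_gt h.1⟩) (hM.mono fun z hz => ?_) (hm.mono fun z hz => ?_) hk⟩
    · rw [abs_of_pos (by linarith [hl.2]), one_mul]
    · rw [abs_of_neg (by linarith [hl.1]), neg_one_mul, neg_neg]
  · rw [boundaryMeasure, add_comm] at hdiv
    refine (infinite_setOf_integral_log_sub_eq hmM hq h1 hM hm hdiv (neg_ne_zero.mpr hr) α).mono ?_
    rintro l ⟨hl, k, hk⟩
    refine ⟨hl, hasEigenvalue_toeplitz_of_integral_log_sub_eq (σ := -1) hq0 hq1 hφ hl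
      (ae_add_measure_iff.mpr ⟨hm.mono fun z hz h => hz.not_gt h.1,
        hM.mono fun z hz h => hz.not_gt h.2⟩) (hm.mono fun z hz => ?_) (hM.mono fun z hz => ?_)
      (k := k) (by linarith)⟩
    · rw [abs_of_neg (by linarith [hl.1]), neg_one_mul, neg_neg]
    · rw [abs_of_pos (by linarith [hl.2]), neg_neg, one_mul]

theorem corollary2p4 (q : ℝ) (hq0 : 0 < q) (hq1 : q < 1) (φ : ℂ → ℝ)
    (hφ : MemLp φ ∞ (AnnulusToeplitz.boundaryMeasure q)) (m M : ℝ) (hm : m < 0) (hM : 0 < M)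
    (hsep :
      (essSup φ (AnnulusToeplitz.circleMeasure q) = m ∧
        M = essInf φ (AnnulusToeplitz.circleMeasure 1)) ∨
      (essSup φ (AnnulusToeplitz.circleMeasure 1) = m ∧
        M = essInf φ (AnnulusToeplitz.circleMeasure q)))
    (hlog : AnnulusToeplitz.LogIntegralEqBot q φ M ∨ AnnulusToeplitz.LogIntegralEqBot q φ m)
    (α : ℝ) (hα : α ∈ Ico (0 : ℝ) 1) :
    {l : ℝ | l ∈ Ioo m M ∧
      Module.End.HasEigenvalue
        (AnnulusToeplitz.toeplitz q α hq0 hq1 φ hφ).toLinearMap (l : ℂ)}.Infinite := by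
  have h1 := hφ.mono_measure (circleMeasure_one_le q)
  have hq := hφ.mono_measure (circleMeasure_le q)
  refine corollary2p4_general q hq0 hq1 φ hφ (hm.trans hM) (hsep.imp ?_ ?_) hlog α
  · exact fun ⟨hS, hI⟩ => ⟨hS ▸ ae_le_essSup_of_memLp_top hq, hI ▸ ae_essInf_le_of_memLp_top h1⟩
  · exact fun ⟨hS, hI⟩ => ⟨hS ▸ ae_le_essSup_of_memLp_top h1, hI ▸ ae_essInf_le_of_memLp_top hq⟩
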